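/- **Virtual links.** Virtual links are represented by Gauss diagrams. A Gauss diagram $D$ consists of finitely many oriented circles and finitely many arrows, each with a sign $\pm1$, whose endpoints are distinct points of the circles. An arrow stands for a classical crossing: its tail lies on the over-crossing strand, its head on the under-crossing strand, and its sign is the crossing sign. Virtual crossings are not recorded, so planar isotopies and detour moves do not change the Gauss diagram. Gauss diagrams are considered up to isomorphism: orientation preserving identifications of the circles that respect the arrows, their directions and their signs. Two Gauss diagrams are *equivalent* if they are related by a finite sequence of isomorphisms and oriented Reidemeister moves $\Omega1,\Omega2,\Omega3$ (and their inverses). The equivalence classes are the virtual link types. **Colorings.** A quandle is a set with a binary operation $*$ such that $x*x=x$, every map $x\mapsto x*y$ is bijective, and $(x*y)*z=(x*z)*(y*z)$. The fundamental quandle $Q(D)$ is generated by the arcs of $D$ (an arc runs from one under-crossing to the next; a circle without under-crossings is one arc). It has one relation for each classical crossing: if $y$ is the over-crossing arc, $x$ the incoming and $z$ the outgoing under-crossing arc, then the relation is $x*y=z$ at a positive crossing and $z*y=x$ at a negative crossing. For a quandle $X$, let $\mathrm{Col}_X(D)=\mathrm{Hom}(Q(D),X)$ be the set of quandle homomorphisms.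 **The $\mathrm{Zh}$-construction.** $\mathrm{Zh}(D)=D\cup\omega$ is obtained from $D$ by adding one circle $\omega$ that crosses over $D$ twice near each classical crossing of $D$, once on each strand. At a crossing $a$ of sign $\varepsilon$, the crossing of $\omega$ with the over-crossing strand has sign $-\varepsilon$, and the crossing of $\omega$ with the under-crossing strand has sign $\varepsilon$. One of the following two pictures is chosen freely at each crossing $a$: either $\omega$ meets the over-crossing strand immediately before $a$ and the under-crossing strand immediately after $a$, or it meets the over-crossing strand immediately after $a$ and the under-crossing strand immediately before $a$. The over-crossings are connected along $\omega$ in an arbitrary order, and there are no further classical crossings. **Theorem.** Let $X$ be a finite quandle and let $D_0,D_1$ be equivalent virtual link diagrams. Then, for all choices made in the constructions of $\mathrm{Zh}(D_0)$ and $\mathrm{Zh}(D_1)$, the sets $\mathrm{Col}_X(\mathrm{Zh}(D_0))$ and $\mathrm{Col}_X(\mathrm{Zh}(D_1))$ are finite and $$|\mathrm{Col}_X(\mathrm{Zh}(D_0))|=|\mathrm{Col}_X(\mathrm{Zh}(D_1))|.$$ -/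

import Mathlib

open scoped Quandles

/-! ### Quandles given by generators and relations

A quandle is Mathlib's `Quandle`, where the operator acts from the left: the product `x * y`
of a right-distributive quandle ("`y` acts on `x`") is written `y ◃ x`. -/

/-- Formal quandle words in the generators `G`. -/
inductive QuandleTerm (G : Type) : Type
  | of (g : G) : QuandleTerm G
  | act (y x : QuandleTerm G) : QuandleTerm G
  | invAct (y x : QuandleTerm G) : QuandleTerm G

/-- The smallest congruence on quandle words that contains `rels` and the quandle axioms. -/
inductive QuandleTerm.Rel {G : Type} (rels : QuandleTerm G → QuandleTerm G → Prop) :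
    QuandleTerm G → QuandleTerm G → Prop
  | of_rels {x y} : rels x y → Rel rels x y
  | refl (x) : Rel rels x x
  | symm {x y} : Rel rels x y → Rel rels y x
  | trans {x y z} : Rel rels x y → Rel rels y z → Rel rels x z
  | congr_act {x x' y y'} : Rel rels x x' → Rel rels y y' → Rel rels (.act x y) (.act x' y')
  | congr_invAct {x x' y y'} :
      Rel rels x x' → Rel rels y y' → Rel rels (.invAct x y) (.invAct x' y')
  | self_distrib (x y z) : Rel rels (.act x (.act y z)) (.act (.act x y) (.act x z))
  | left_inv (x y) : Rel rels (.invAct x (.act x y)) y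
  | right_inv (x y) : Rel rels (.act x (.invAct x y)) y
  | fix (x) : Rel rels (.act x x) x

def QuandleTerm.setoid {G : Type} (rels : QuandleTerm G → QuandleTerm G → Prop) :
    Setoid (QuandleTerm G) where
  r := QuandleTerm.Rel rels
  iseqv := ⟨.refl, .symm, .trans⟩

/-- The quandle with generators `G` and defining relations `rels`. -/
def PresentedQuandle {G : Type} (rels : QuandleTerm G → QuandleTerm G → Prop) : Type :=
  Quotient (QuandleTerm.setoid rels)

instance PresentedQuandle.instQuandle {G : Type} (rels : QuandleTerm G → QuandleTerm G → Prop) :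
    Quandle (PresentedQuandle rels) where
  act := Quotient.map₂ .act fun _ _ hx _ _ hy => .congr_act hx hy
  invAct := Quotient.map₂ .invAct fun _ _ hx _ _ hy => .congr_invAct hx hy
  self_distrib := by
    rintro ⟨x⟩ ⟨y⟩ ⟨z⟩
    exact Quotient.sound (.self_distrib x y z)
  left_inv := by
    rintro ⟨x⟩ ⟨y⟩
    exact Quotient.sound (.left_inv x y)
  right_inv := by
    rintro ⟨x⟩ ⟨y⟩
    exact Quotient.sound (.right_inv x y)
  fix := by
    rintro ⟨x⟩
    exact Quotient.sound (.fix x)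

/-! ### Gauss diagrams -/

/-- The two passages through a classical crossing: the over-crossing and the under-crossing. -/
inductive Pass : Type
  | above
  | below

/-- The Gauss diagram of an oriented virtual link diagram. The circles are indexed by `Comp`, the
arrows (classical crossings) by `Arrow`. The endpoints of the arrow `a` are `(a, .above)` (its tail)
and `(a, .below)` (its head). `word i` lists the endpoints met when the `i`-th circle is traversed
once in its direction; only its class up to rotation matters (see `GaussDiagram.Iso`), and it
is empty for a circle without classical crossings. Every endpoint lies on exactly one circle and
is met there exactly once. -/
structure GaussDiagram : Type 1 where
  Comp : Type
  Arrow : Type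
  finite_comp : Finite Comp
  finite_arrow : Finite Arrow
  sign : Arrow → ℤˣ
  word : Comp → List (Arrow × Pass)
  nodup : ∀ i, (word i).Nodup
  existsUnique_comp : ∀ e, ∃! i, e ∈ word i

namespace GaussDiagram

/-- The endpoints of the arrows of `D`. -/
abbrev End (D : GaussDiagram) : Type := D.Arrow × Pass

/-- `D.Follows e f`: on the circle that carries them, the arrow endpoint `f` is the one that comes
immediately after `e` (with `f = e` if `e` is the only endpoint on its circle). -/
def Follows (D : GaussDiagram) (e f : D.End) : Prop :=
  ∃ i l, D.word i ~r l ∧ l.getLast? = some e ∧ l.head? = some f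

/-- Isomorphism of Gauss diagrams: orientation preserving identifications of the circles that
preserve the arrows with their signs and directions. -/
def Iso (D D' : GaussDiagram) : Prop :=
  ∃ (c : D.Comp ≃ D'.Comp) (φ : D.Arrow ≃ D'.Arrow),
    (∀ a, D'.sign (φ a) = D.sign a) ∧
    ∀ i, (D.word i).map (Prod.map φ id) ~r D'.word (c i)

open Classical in
/-- The Gauss diagram obtained by erasing the arrows in `S`. -/
noncomputable def delete (D : GaussDiagram) (S : Set D.Arrow) : GaussDiagram where
  Comp := D.Comp
  Arrow := {a : D.Arrow // a ∉ S}
  finite_comp := D.finite_comp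
  finite_arrow := by
    have := D.finite_arrow
    infer_instance
  sign a := D.sign a
  word i := (D.word i).filterMap fun e => if h : e.1 ∉ S then some (⟨e.1, h⟩, e.2) else none
  nodup i := by
    refine (D.nodup i).filterMap ?_
    rintro ⟨a, p⟩ ⟨a', p'⟩ ⟨b, q⟩ h h'
    simp only [Option.mem_def, Option.dite_none_right_eq_some, Option.some.injEq,
      Prod.mk.injEq] at h h'
    obtain ⟨_, rfl, rfl⟩ := h
    obtain ⟨_, h1, rfl⟩ := h'
    simpa using (congrArg Subtype.val h1).symm
  existsUnique_comp := by
    rintro ⟨⟨a, ha⟩, p⟩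
    have key : ∀ i, ((⟨⟨a, ha⟩, p⟩ : {a : D.Arrow // a ∉ S} × Pass) ∈
        (D.word i).filterMap fun e => if h : e.1 ∉ S then some (⟨e.1, h⟩, e.2) else none) ↔
        (a, p) ∈ D.word i := by
      intro i
      simp only [List.mem_filterMap, Option.dite_none_right_eq_some, Option.some.injEq,
        Prod.mk.injEq, Subtype.mk.injEq, Prod.exists]
      constructor
      · rintro ⟨b, q, hb, _, rfl, rfl⟩
        exact hb
      · intro h
        exact ⟨a, p, h, ha, rfl, rfl⟩
    simpa only [key] using D.existsUnique_comp (a, p)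

/-- The Gauss diagram obtained by permuting the arrow endpoints among their places: the place of
`e` is taken by `τ e`. -/
def permute (D : GaussDiagram) (τ : Equiv.Perm D.End) : GaussDiagram where
  Comp := D.Comp
  Arrow := D.Arrow
  finite_comp := D.finite_comp
  finite_arrow := D.finite_arrow
  sign := D.sign
  word i := (D.word i).map τ
  nodup i := (D.nodup i).map τ.injective
  existsUnique_comp e := by
    have key : ∀ i, e ∈ (D.word i).map τ ↔ τ.symm e ∈ D.word i := by
      intro i
      rw [List.mem_map]
      constructor
      · rintro ⟨f, hf, rfl⟩
        simpa using hf
      · intro h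
        exact ⟨_, h, by simp⟩
    simpa only [key] using D.existsUnique_comp (τ.symm e)

/-- `e` and `f` are adjacent: `f` follows `e` if `x = 1`, and `e` follows `f` if `x = -1`. -/
def AdjacentInOrder (D : GaussDiagram) (x : ℤˣ) (e f : D.End) : Prop :=
  (x = 1 ∧ D.Follows e f) ∨ (x = -1 ∧ D.Follows f e)

/-- The configurations of the third Reidemeister move. The top strand passes over the middle
strand at `tm` and over the bottom strand at `tb`, and the middle strand passes over the bottom
strand at `mb`. The signs `xt`, `xm`, `xb` record the order of the two crossings along the top,
the middle and the bottom strand, relative to the orders `tm, tb`, `tm, mb` and `tb, mb`.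
Three oriented lines in general position in the plane, labelled top, middle and bottom, satisfy
the last condition, and every choice of signs that satisfies it comes from three such lines. -/
def IsTriangle (D : GaussDiagram) (tm tb mb : D.Arrow) : Prop :=
  tm ≠ tb ∧ tm ≠ mb ∧ tb ≠ mb ∧
  ∃ xt xm xb : ℤˣ,
    D.AdjacentInOrder xt (tm, .above) (tb, .above) ∧
    D.AdjacentInOrder xm (tm, .below) (mb, .above) ∧
    D.AdjacentInOrder xb (tb, .below) (mb, .below) ∧
    xt * D.sign mb = xm * D.sign tb ∧ xm * D.sign tb = xb * D.sign tm

open Classical in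
/-- The exchange of the two adjacent arrow endpoints on each of the three strands of a triangle. -/
noncomputable def triangleSwap (D : GaussDiagram) (tm tb mb : D.Arrow) : Equiv.Perm D.End :=
  Equiv.swap (tm, .above) (tb, .above) * Equiv.swap (tm, .below) (mb, .above) *
    Equiv.swap (tb, .below) (mb, .below)

/-- The oriented Reidemeister moves on Gauss diagrams, together with isomorphism. Moves on virtual
crossings (detour moves) do not change the Gauss diagram. -/
inductive Move : GaussDiagram → GaussDiagram → Prop
  | iso {D D' : GaussDiagram} : D.Iso D' → Move D D'
  /-- `Ω1`: an arrow (of either sign) with adjacent endpoints is erased. -/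
  | omega1 (D : GaussDiagram) (a : D.Arrow) :
      (D.Follows (a, .above) (a, .below) ∨ D.Follows (a, .below) (a, .above)) →
      Move D (D.delete {a})
  /-- `Ω2`: two arrows of opposite signs with adjacent tails and adjacent heads are erased. -/
  | omega2 (D : GaussDiagram) (a b : D.Arrow) :
      a ≠ b → D.sign a = -D.sign b → D.Follows (a, .above) (b, .above) →
      (D.Follows (a, .below) (b, .below) ∨ D.Follows (b, .below) (a, .below)) →
      Move D (D.delete {a, b})
  /-- `Ω3`: the third Reidemeister move. -/
  | omega3 (D : GaussDiagram) (tm tb mb : D.Arrow) :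
      D.IsTriangle tm tb mb → Move D (D.permute (D.triangleSwap tm tb mb))

/-- Virtual Reidemeister equivalence. -/
def VirtuallyEquivalent (D D' : GaussDiagram) : Prop := Relation.EqvGen Move D D'

/-! ### The fundamental quandle and colorings -/

/-- The short arcs: `.inl e` is the one that begins at the arrow endpoint `e` (and ends at the next
endpoint on the circle); `.inr i` is a whole circle without arrow endpoints. -/
def ShortArc (D : GaussDiagram) : Type := D.End ⊕ {i : D.Comp // D.word i = []}

/-- `D.EndsAt s f`: the short arc `s` ends at the arrow endpoint `f`. -/
def EndsAt (D : GaussDiagram) (s : D.ShortArc) (f : D.End) : Prop :=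
  ∃ e, s = .inl e ∧ D.Follows e f

/-- The arcs, which run from one under-crossing to the next: short arcs that meet at
an over-crossing are joined. -/
def Arc (D : GaussDiagram) : Type :=
  Quot fun s t : D.ShortArc => ∃ a, D.EndsAt s (a, .above) ∧ t = .inl (a, .above)

/-- The arc that contains a short arc. -/
def arc (D : GaussDiagram) (s : D.ShortArc) : D.Arc := Quot.mk _ s

/-- The relations of the fundamental quandle. At a crossing with over-crossing arc `y`, incoming
under-crossing arc `x` and outgoing under-crossing arc `z`, the relation is `x * y = z` if the
crossing is positive, and `z * y = x` if it is negative. -/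
inductive CrossingRel (D : GaussDiagram) : QuandleTerm D.Arc → QuandleTerm D.Arc → Prop
  | pos (a : D.Arrow) (s : D.ShortArc) : D.sign a = 1 → D.EndsAt s (a, .below) →
      CrossingRel D (.act (.of (D.arc (.inl (a, .above)))) (.of (D.arc s)))
        (.of (D.arc (.inl (a, .below))))
  | neg (a : D.Arrow) (s : D.ShortArc) : D.sign a = -1 → D.EndsAt s (a, .below) →
      CrossingRel D (.act (.of (D.arc (.inl (a, .above)))) (.of (D.arc (.inl (a, .below)))))
        (.of (D.arc s))

/-- The fundamental quandle `Q(D)`. -/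
abbrev FundamentalQuandle (D : GaussDiagram) : Type := PresentedQuandle D.CrossingRel

/-- The set `Col_X(D)` of colorings of `D` by the quandle `X`. -/
abbrev Col (X : Type*) [Quandle X] (D : GaussDiagram) : Type _ := D.FundamentalQuandle →◃ X

/-! ### The Zh-construction -/

/-- The choices made in the Zh-construction: for every crossing `a` of `D`, on which side the two
arcs of `ω` are drawn, and in which order the resulting over-crossings, one for each arrow endpoint
of `D`, are connected along `ω`.

If `overFirst a` holds, the over-strand of `a` passes below `ω` immediately before `a` and the
under-strand passes below `ω` immediately after `a`. Otherwise, the over-strand passes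
below `ω` immediately after `a` and the under-strand immediately before `a`. -/
structure ZhChoice (D : GaussDiagram) where
  overFirst : D.Arrow → Prop
  order : List D.End
  order_nodup : order.Nodup
  mem_order : ∀ e, e ∈ order

/-- Whether the strand passes below `ω` immediately before (rather than after) the endpoint. -/
def ZhChoice.Before {D : GaussDiagram} (z : D.ZhChoice) : D.End → Prop
  | (a, .above) => z.overFirst a
  | (a, .below) => ¬ z.overFirst a

/-- The sign of the crossing of `ω` with `D` next to an arrow endpoint. -/
def zhSign (D : GaussDiagram) : D.End → ℤˣ
  | (a, .above) => -D.sign a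
  | (a, .below) => D.sign a

open Classical in
/-- The two passages replacing the passage `e` of `D`: `e` itself, and the passage of the strand
below `ω` next to it. -/
noncomputable def ZhChoice.block {D : GaussDiagram} (z : D.ZhChoice) (e : D.End) :
    List ((D.Arrow ⊕ D.End) × Pass) :=
  if z.Before e then [(.inr e, .below), (.inl e.1, e.2)] else [(.inl e.1, e.2), (.inr e, .below)]

theorem ZhChoice.mem_block {D : GaussDiagram} (z : D.ZhChoice) (e : D.End)
    (x : (D.Arrow ⊕ D.End) × Pass) :
    x ∈ z.block e ↔ x = (.inr e, .below) ∨ x = (.inl e.1, e.2) := by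
  unfold ZhChoice.block
  split_ifs <;> simp [or_comm]

/-- The diagram `Zh(D) = D ∪ ω`. The crossings are those of `D` (`.inl a`) and, for every arrow
endpoint `e` of `D`, one crossing (`.inr e`) at which `ω` passes over `D`. The components are those
of `D` (`some i`) and `ω` (`none`). -/
noncomputable def zh (D : GaussDiagram) (z : D.ZhChoice) : GaussDiagram where
  Comp := Option D.Comp
  Arrow := D.Arrow ⊕ D.End
  finite_comp := by
    have := D.finite_comp
    infer_instance
  finite_arrow := by
    have := D.finite_arrow
    have : Finite Pass :=
      Finite.of_surjective (fun b : Bool => if b then Pass.above else Pass.below)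
        (by rintro (_ | _); exacts [⟨true, rfl⟩, ⟨false, rfl⟩])
    infer_instance
  sign := Sum.elim D.sign D.zhSign
  word
    | none => z.order.map fun e => (.inr e, .above)
    | some i => (D.word i).flatMap z.block
  nodup := by
    rintro (_ | i)
    · refine z.order_nodup.map ?_
      intro e f h
      simpa using h
    · refine List.nodup_flatMap.2 ⟨fun e _ => ?_, (D.nodup i).imp ?_⟩
      · unfold ZhChoice.block
        split_ifs <;> simp
      · intro e f hef x hx hx'
        rw [ZhChoice.mem_block] at hx hx'
        apply hef
        rcases hx with rfl | rfl <;> rcases hx' with h | h <;> simp at h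
        · exact h
        · exact Prod.ext h.1 h.2
  existsUnique_comp := by
    have aux : ∀ (e : D.End) (x : (D.Arrow ⊕ D.End) × Pass),
        (x = (.inr e, .below) ∨ x = (.inl e.1, e.2)) → (∀ f : D.End, x ≠ (.inr f, .above)) →
        ∃! i : Option D.Comp, x ∈ (match i with
          | none => z.order.map fun e => ((Sum.inr e, Pass.above) : (D.Arrow ⊕ D.End) × Pass)
          | some i => (D.word i).flatMap z.block) := by
      intro e x hx hx'
      obtain ⟨i, hi, hu⟩ := D.existsUnique_comp e
      refine ⟨some i, List.mem_flatMap.2 ⟨e, hi, (z.mem_block e x).2 hx⟩, ?_⟩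
      rintro (_ | j) hj
      · obtain ⟨f, -, hf⟩ := List.mem_map.1 hj
        exact absurd hf.symm (hx' f)
      · obtain ⟨f, hf, hxf⟩ := List.mem_flatMap.1 hj
        rw [ZhChoice.mem_block] at hxf
        have hef : f = e := by
          rcases hx with rfl | rfl <;> rcases hxf with h | h <;> simp at h
          · exact h.symm
          · exact (Prod.ext h.1 h.2).symm
        subst hef
        rw [hu j hf]
    rintro ⟨a | e, p⟩
    · exact aux (a, p) _ (.inr rfl) (by simp)
    · cases p with
      | below => exact aux e _ (.inl rfl) (by simp)
      | above =>
        refine ⟨none, List.mem_map.2 ⟨e, z.mem_order e, rfl⟩, ?_⟩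
        rintro (_ | j) hj
        · rfl
        · obtain ⟨f, hf, hxf⟩ := List.mem_flatMap.1 hj
          rw [ZhChoice.mem_block] at hxf
          rcases hxf with h | h <;> simp at h

end GaussDiagram

/-! ### Rotations of lists -/

/-! The circle `ω` only crosses over, so in a coloring of `Zh(D)` it carries a single color `w`. Fix
`w` and let it act by the automorphism `Rack.act' w`. Near a crossing of sign `s` the over-strand is
then shifted by the power `-s` of this automorphism and the under-strand by the power `s`. Absorbing
these shifts into the crossing gives a rule on `D` itself (`zhRule w`): an over-strand of incoming
color `y` leaves with `w^(-s) y`, an under-strand of incoming color `x` leaves with `y^s w^s x`,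
where powers denote the actions. Since `w` acts by automorphisms, both pictures allowed at a
crossing give this same rule (`IsBlockColoring.out_second`), and the order along `ω` is irrelevant
because its color is constant. Hence `Col_X(Zh(D))` is the disjoint union over `w` of the colorings
of `D` by `zhRule w` (`nonempty_col_zh_equiv`), and all choices have disappeared.

For each fixed `w`, the number of colorings by `zhRule w` is invariant under the Reidemeister moves.
For the first move this rests on idempotence (`out_below_eq_above_iff`), for the second on the
cancellation `zhRule_below_mul`, for the third on self-distributivity together with the sign
conditions of a triangle (`zhRule_triangle`). The two erasing moves share one counting argument
(`card_coloring_delete`): a strand leaves a pair of erased crossings with the color with which it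
entered. Summing over `w` gives the theorem. -/

theorem List.IsRotated.exists_append {α : Type*} {l l' : List α} (h : l ~r l') :
    ∃ u v, l = u ++ v ∧ l' = v ++ u := by
  obtain ⟨n, rfl⟩ := h
  exact ⟨l.take (n % l.length), l.drop (n % l.length), (List.take_append_drop _ _).symm,
    List.rotate_eq_drop_append_take_mod⟩

theorem List.IsRotated.filterMap {α β : Type*} {l l' : List α} (h : l ~r l') (f : α → Option β) :
    l.filterMap f ~r l'.filterMap f := by
  obtain ⟨u, v, rfl, rfl⟩ := h.exists_append
  simpa only [List.filterMap_append] using List.isRotated_append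

/-- Without repetitions, the first entry fixes the rotation. This and its analogue for the last
entry make `Follows` injective and single-valued. -/
theorem List.IsRotated.eq_of_head? {α : Type*} {l l' : List α} (h : l ~r l') (hl : l.Nodup) {f : α}
    (hf : l.head? = some f) (hf' : l'.head? = some f) : l = l' := by
  obtain ⟨u, v, rfl, rfl⟩ := h.exists_append
  rcases u with _ | ⟨a, u⟩
  · simp
  rcases v with _ | ⟨b, v⟩
  · simp
  simp only [List.cons_append, List.head?_cons, Option.some.injEq] at hf hf'
  subst hf hf'
  simp at hl

theorem List.IsRotated.eq_of_getLast? {α : Type*} {l l' : List α} (h : l ~r l') (hl : l.Nodup)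
    {e : α} (he : l.getLast? = some e) (he' : l'.getLast? = some e) : l = l' := by
  obtain ⟨u, v, rfl, rfl⟩ := h.exists_append
  rcases List.eq_nil_or_concat u with rfl | ⟨u, a, rfl⟩
  · simp
  rcases List.eq_nil_or_concat v with rfl | ⟨v, b, rfl⟩
  · simp
  simp only [List.concat_eq_append, ← List.append_assoc, List.getLast?_append,
    List.getLast?_singleton, Option.some_or, Option.some.injEq] at he he'
  subst he he'
  simp [List.nodup_append] at hl

/-! ### Transporting a color along a strand -/

/-- A strand that carries the color `x` meets the endpoints in the list one after the other and
carries the color `y` in the end. At an endpoint `e`, its color changes from `i e` to `o e`. -/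
def Traverse {E : Type*} {X : Type*} (i o : E → X) : X → List E → X → Prop
  | x, [], y => x = y
  | x, e :: l, y => x = i e ∧ Traverse i o (o e) l y

section Traverse

variable {E : Type*} {X : Type*} {i o : E → X}

@[simp]
theorem traverse_nil {x y : X} : Traverse i o x [] y ↔ x = y := Iff.rfl

@[simp]
theorem traverse_cons {x y : X} {e : E} {l : List E} :
    Traverse i o x (e :: l) y ↔ x = i e ∧ Traverse i o (o e) l y := Iff.rfl

theorem traverse_append {x y : X} {l l' : List E} :
    Traverse i o x (l ++ l') y ↔ ∃ m, Traverse i o x l m ∧ Traverse i o m l' y := by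
  induction l generalizing x with
  | nil => simp
  | cons e l ih => simp [ih, and_assoc]

theorem Traverse.eq_of_head? {x y : X} {l : List E} (h : Traverse i o x l y) {f : E}
    (hf : l.head? = some f) : x = i f := by
  cases l with
  | nil => simp at hf
  | cons e l =>
    obtain rfl : e = f := by simpa using hf
    exact h.1

theorem Traverse.eq_of_getLast? {x y : X} {l : List E} (h : Traverse i o x l y) {e : E}
    (he : l.getLast? = some e) : o e = y := by
  rcases List.eq_nil_or_concat l with rfl | ⟨l, a, rfl⟩
  · simp at he
  · obtain rfl : a = e := by simpa using he
    rw [List.concat_eq_append, traverse_append] at h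
    obtain ⟨m, -, -, h⟩ := h
    exact h

/-- The local form of a traversal: colors need only match between neighbours and at the end of the
list. -/
theorem traverse_of_adjacent {l : List E} (e : E) {y : X}
    (h : ∀ u e' f v, e :: l = u ++ e' :: f :: v → o e' = i f)
    (hy : ∀ e', (e :: l).getLast? = some e' → o e' = y) : Traverse i o (i e) (e :: l) y := by
  induction l generalizing e with
  | nil => simpa using hy e
  | cons f l ih =>
    refine ⟨rfl, ?_⟩
    rw [h [] e f l rfl]
    refine ih f (fun u e' f' v huv => h (e :: u) e' f' v (by rw [huv, List.cons_append])) ?_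
    intro e' he'
    exact hy e' (by simpa using he')

end Traverse

namespace GaussDiagram

/-! ### The successor relation of arrow endpoints -/

instance instFiniteComp (D : GaussDiagram) : Finite D.Comp := D.finite_comp

instance instFiniteArrow (D : GaussDiagram) : Finite D.Arrow := D.finite_arrow

instance instFinitePass : Finite Pass :=
  Finite.of_surjective (fun b : Bool => if b then Pass.above else Pass.below)
    (by rintro (_ | _); exacts [⟨true, rfl⟩, ⟨false, rfl⟩])

theorem word_injective (D : GaussDiagram) {j k : D.Comp} {e : D.End} (hj : e ∈ D.word j)
    (hk : e ∈ D.word k) : j = k :=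
  (D.existsUnique_comp e).unique hj hk

theorem Follows.exists_rotation {D : GaussDiagram} {e f : D.End} (h : D.Follows e f) :
    ∃ j l, e ∈ D.word j ∧ f ∈ D.word j ∧ D.word j ~r l ∧ l.getLast? = some e ∧
      l.head? = some f := by
  obtain ⟨j, l, hl, he, hf⟩ := h
  exact ⟨j, l, hl.mem_iff.2 (List.mem_of_getLast? he), hl.mem_iff.2 (List.mem_of_head? hf), hl,
    he, hf⟩

theorem Follows.left_unique {D : GaussDiagram} {e e' f : D.End} (h : D.Follows e f)
    (h' : D.Follows e' f) : e = e' := by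
  obtain ⟨j, l, -, hj, hl, he, hf⟩ := h.exists_rotation
  obtain ⟨j', l', -, hj', hl', he', hf'⟩ := h'.exists_rotation
  obtain rfl := D.word_injective hj hj'
  have := (hl.symm.trans hl').eq_of_head? (hl.nodup_iff.1 (D.nodup j)) hf hf'
  subst this
  exact Option.some.inj (he.symm.trans he')

theorem Follows.right_unique {D : GaussDiagram} {e f f' : D.End} (h : D.Follows e f)
    (h' : D.Follows e f') : f = f' := by
  obtain ⟨j, l, hj, -, hl, he, hf⟩ := h.exists_rotation
  obtain ⟨j', l', hj', -, hl', he', hf'⟩ := h'.exists_rotation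
  obtain rfl := D.word_injective hj hj'
  have := (hl.symm.trans hl').eq_of_getLast? (hl.nodup_iff.1 (D.nodup j)) he he'
  subst this
  exact Option.some.inj (hf.symm.trans hf')

theorem exists_follows_left (D : GaussDiagram) (f : D.End) : ∃ e, D.Follows e f := by
  obtain ⟨j, hj, -⟩ := D.existsUnique_comp f
  obtain ⟨u, v, huv⟩ := List.append_of_mem hj
  have hne : (f :: v ++ u) ≠ [] := by simp
  refine ⟨(f :: v ++ u).getLast hne, j, f :: v ++ u, ?_, List.getLast?_eq_some_getLast hne,
    by simp⟩
  rw [huv]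
  exact List.isRotated_append

theorem follows_of_rotated_append (D : GaussDiagram) {j : D.Comp} {u v : List D.End} {e f : D.End}
    (h : D.word j ~r u ++ e :: f :: v) : D.Follows e f := by
  refine ⟨j, f :: v ++ (u ++ [e]), h.trans ?_, ?_, by simp⟩
  on_goal 2 => rw [← List.append_assoc, List.getLast?_concat]
  rw [show u ++ e :: f :: v = (u ++ [e]) ++ f :: v by simp]
  exact List.isRotated_append

theorem follows_of_getLast?_head? (D : GaussDiagram) {j : D.Comp} {e f : D.End}
    (he : (D.word j).getLast? = some e) (hf : (D.word j).head? = some f) : D.Follows e f :=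
  ⟨j, D.word j, .refl _, he, hf⟩

/-! ### Colorings with prescribed crossing rules -/

/-- A crossing rule assigns to the sign of a crossing, one of its two strands and the color of the
incoming over-crossing strand a bijection, from the incoming to the outgoing color. -/
abbrev CrossingRule (X : Type*) := ℤˣ → Pass → X → Equiv.Perm X

variable {X : Type*}

/-- The outgoing color at an endpoint when the incoming colors are given. -/
def out (D : GaussDiagram) (K : CrossingRule X) (i : D.End → X) (e : D.End) : X :=
  K (D.sign e.1) e.2 (i (e.1, .above)) (i e)

/-- `b` lists the colors at the base points of the circles, `i` the incoming colors at the arrow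
endpoints. -/
def IsColoring (D : GaussDiagram) (K : CrossingRule X) (b : D.Comp → X) (i : D.End → X) : Prop :=
  ∀ j, Traverse i (D.out K i) (b j) (D.word j) (b j)

/-- The base colors are part of the data for the sake of circles without endpoints, whose color is
free. On every other circle they are determined by the incoming colors. -/
def Coloring (D : GaussDiagram) (K : CrossingRule X) : Type _ :=
  {c : (D.Comp → X) × (D.End → X) // D.IsColoring K c.1 c.2}

instance (D : GaussDiagram) (K : CrossingRule X) [Finite X] : Finite (D.Coloring K) :=
  Subtype.finite

theorem IsColoring.out_eq {D : GaussDiagram} {K : CrossingRule X} {b : D.Comp → X} {i : D.End → X}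
    (h : D.IsColoring K b i) {e f : D.End} (hef : D.Follows e f) : D.out K i e = i f := by
  obtain ⟨j, l, hl, he, hf⟩ := hef
  obtain ⟨u, v, huv, rfl⟩ := hl.exists_append
  have hj := h j
  rw [huv, traverse_append] at hj
  obtain ⟨m, hu, hv⟩ := hj
  -- A closed traversal may be started at any point of the circle; here it starts at `f`.
  have : Traverse i (D.out K i) m (v ++ u) m := traverse_append.2 ⟨_, hv, hu⟩
  rw [this.eq_of_getLast? he, this.eq_of_head? hf]

theorem IsColoring.base_eq {D : GaussDiagram} {K : CrossingRule X} {b : D.Comp → X} {i : D.End → X}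
    (h : D.IsColoring K b i) {j : D.Comp} {f : D.End} (hf : (D.word j).head? = some f) :
    b j = i f :=
  (h j).eq_of_head? hf

/-- With `IsColoring.out_eq` and `IsColoring.base_eq` this describes colorings by the cyclic
successor relation, which does not see base points. -/
theorem isColoring_of_follows {D : GaussDiagram} {K : CrossingRule X} {b : D.Comp → X}
    {i : D.End → X} (h : ∀ e f, D.Follows e f → D.out K i e = i f)
    (hb : ∀ j f, (D.word j).head? = some f → b j = i f) : D.IsColoring K b i := by
  intro j
  rcases hj : D.word j with _ | ⟨e, l⟩
  · simp
  · rw [hb j e (by simp [hj])]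
    refine traverse_of_adjacent e (fun u e' f v huv => ?_) fun e' he' => ?_
    · exact h _ _ (D.follows_of_rotated_append (j := j) (u := u) (v := v) (by rw [hj, huv]))
    · exact h _ _ (D.follows_of_getLast?_head? (j := j) (by rw [hj, he']) (by simp [hj]))

/-- The colors of the base points that fit to given incoming colors; `b` is used for the circles
without arrow endpoints. -/
def baseColor (D : GaussDiagram) (b : D.Comp → X) (i : D.End → X) (j : D.Comp) : X :=
  ((D.word j).head?.map i).getD (b j)

theorem baseColor_of_nil {D : GaussDiagram} (b : D.Comp → X) (i : D.End → X) {j : D.Comp}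
    (hj : D.word j = []) : D.baseColor b i j = b j := by
  simp [baseColor, hj]

theorem isColoring_baseColor {D : GaussDiagram} {K : CrossingRule X} (b : D.Comp → X)
    {i : D.End → X} (h : ∀ e f, D.Follows e f → D.out K i e = i f) :
    D.IsColoring K (D.baseColor b i) i :=
  isColoring_of_follows h fun j f hf => by simp [baseColor, hf]

theorem IsColoring.ext {D : GaussDiagram} {K : CrossingRule X} {b b' : D.Comp → X} {i : D.End → X}
    (h : D.IsColoring K b i) (h' : D.IsColoring K b' i)
    (hb : ∀ j, D.word j = [] → b j = b' j) : b = b' := by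
  funext j
  rcases hj : D.word j with _ | ⟨e, l⟩
  · exact hb j hj
  · rw [h.base_eq (f := e) (by simp [hj]), h'.base_eq (f := e) (by simp [hj])]

/-- Each move is treated by a relation between colorings before and after it. Totality supplies a
map by choice, and the second condition makes that map injective. -/
theorem card_coloring_le {D D' : GaussDiagram} {K : CrossingRule X} [Finite X]
    (R : (D.Comp → X) → (D.End → X) → (D'.Comp → X) → (D'.End → X) → Prop)
    (total : ∀ b i, D.IsColoring K b i → ∃ b' i', D'.IsColoring K b' i' ∧ R b i b' i')
    (inj : ∀ b₁ i₁ b₂ i₂ b' i', D.IsColoring K b₁ i₁ → D.IsColoring K b₂ i₂ →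
      D'.IsColoring K b' i' → R b₁ i₁ b' i' → R b₂ i₂ b' i' → b₁ = b₂ ∧ i₁ = i₂) :
    Nat.card (D.Coloring K) ≤ Nat.card (D'.Coloring K) := by
  choose B I hBI hR using total
  refine Nat.card_le_card_of_injective
    (fun c => (⟨(B _ _ c.2, I _ _ c.2), hBI _ _ c.2⟩ : D'.Coloring K)) ?_
  rintro ⟨⟨b₁, i₁⟩, h₁⟩ ⟨⟨b₂, i₂⟩, h₂⟩ h
  obtain ⟨hB, hI⟩ := Prod.ext_iff.1 (Subtype.ext_iff.1 h)
  have h2 := hR _ _ h₂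
  dsimp only at hB hI h2
  rw [← hB, ← hI] at h2
  obtain ⟨rfl, rfl⟩ := inj _ _ _ _ _ _ h₁ h₂ (hBI _ _ h₁) (hR _ _ h₁) h2
  rfl

end GaussDiagram

theorem nonempty_equiv_of_rel {A B : Type*} (R : A → B → Prop) (exists_right : ∀ a, ∃ b, R a b)
    (exists_left : ∀ b, ∃ a, R a b) (left_unique : ∀ a a' b, R a b → R a' b → a = a')
    (right_unique : ∀ a b b', R a b → R a b' → b = b') : Nonempty (A ≃ B) := by
  choose F hF using exists_right
  choose G hG using exists_left
  exact ⟨⟨F, G, fun a =>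
    left_unique _ _ _ (hG _) (hF a),
    fun b => right_unique _ _ _ (hF _) (hG b)⟩⟩

/-! ### Homomorphisms from a presented quandle -/

section Presented

variable {G : Type} {X : Type*} [Quandle X]

/-- The value of a word when values of the generators are given. -/
def QuandleTerm.eval (g : G → X) : QuandleTerm G → X
  | .of a => g a
  | .act y x => y.eval g ◃ x.eval g
  | .invAct y x => y.eval g ◃⁻¹ x.eval g

theorem QuandleTerm.Rel.eval_eq {rels : QuandleTerm G → QuandleTerm G → Prop} {g : G → X}
    (hg : ∀ s t, rels s t → s.eval g = t.eval g) {s t : QuandleTerm G}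
    (h : QuandleTerm.Rel rels s t) : s.eval g = t.eval g := by
  induction h with
  | of_rels h => exact hg _ _ h
  | refl => rfl
  | symm _ ih => exact ih.symm
  | trans _ _ ih ih' => exact ih.trans ih'
  | congr_act _ _ ih ih' => simp only [QuandleTerm.eval, ih, ih']
  | congr_invAct _ _ ih ih' => simp only [QuandleTerm.eval, ih, ih']
  | self_distrib => exact Shelf.self_distrib
  | left_inv x y => exact Rack.invAct_act_eq _ _
  | right_inv x y => exact Rack.act_invAct_eq _ _
  | fix => exact Quandle.fix

namespace PresentedQuandle

variable {rels : QuandleTerm G → QuandleTerm G → Prop}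

/-- The class of a quandle word. -/
def mk (rels : QuandleTerm G → QuandleTerm G → Prop) (t : QuandleTerm G) :
    PresentedQuandle rels :=
  Quotient.mk (QuandleTerm.setoid rels) t

/-- The homomorphism with prescribed values of the generators. -/
def lift (g : G → X) (hg : ∀ s t, rels s t → s.eval g = t.eval g) : PresentedQuandle rels →◃ X where
  toFun := Quotient.lift (QuandleTerm.eval g) fun _ _ h => QuandleTerm.Rel.eval_eq hg h
  map_act' := by
    rintro ⟨x⟩ ⟨y⟩
    rfl

theorem hom_mk (f : PresentedQuandle rels →◃ X) (t : QuandleTerm G) :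
    f (mk rels t) = t.eval fun a => f (mk rels (.of a)) := by
  induction t with
  | of => rfl
  | act y x ihy ihx =>
    rw [QuandleTerm.eval, ← ihy, ← ihx, ← f.map_act]
    rfl
  | invAct y x ihy ihx =>
    rw [QuandleTerm.eval, ← ihy, ← ihx, ← Rack.left_cancel (f (mk rels y)), Rack.act_invAct_eq,
      ← f.map_act]
    congr 1
    exact Rack.act_invAct_eq (mk rels y) (mk rels x)

theorem hom_ext {f f' : PresentedQuandle rels →◃ X}
    (h : ∀ a, f (mk rels (.of a)) = f' (mk rels (.of a))) : f = f' := by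
  refine DFunLike.ext _ _ ?_
  rintro ⟨t⟩
  change f (mk rels t) = f' (mk rels t)
  rw [hom_mk, hom_mk, funext h]

theorem eval_eq_of_rels (f : PresentedQuandle rels →◃ X) {s t : QuandleTerm G} (h : rels s t) :
    (s.eval fun a => f (mk rels (.of a))) = t.eval fun a => f (mk rels (.of a)) := by
  rw [← hom_mk, ← hom_mk]
  exact congrArg f (Quotient.sound (.of_rels h))

end PresentedQuandle

end Presented

/-! ### Quandle homomorphisms as colorings with a crossing rule. -/

namespace GaussDiagram

variable {X : Type*} [Quandle X]

/-- The crossing rule of quandle colorings. -/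
def quandleRule (X : Type*) [Quandle X] : CrossingRule X
  | _, .above, _ => 1
  | s, .below, y => Rack.act' y ^ (s : ℤ)

/-- The crossing rule that arises from quandle colorings of `Zh(D)` if `ω` has the color `w`. -/
def zhRule (w : X) : CrossingRule X
  | s, .above, _ => Rack.act' w ^ (-(s : ℤ))
  | s, .below, y => Rack.act' y ^ (s : ℤ) * Rack.act' w ^ (s : ℤ)

/-- The color of a short arc in a coloring by homomorphism. -/
def shortArcColor (D : GaussDiagram) (f : D.FundamentalQuandle →◃ X) (s : D.ShortArc) : X :=
  f (PresentedQuandle.mk _ (.of (D.arc s)))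

theorem shortArcColor_above {D : GaussDiagram} (f : D.FundamentalQuandle →◃ X) {s : D.ShortArc}
    {a : D.Arrow} (hs : D.EndsAt s (a, .above)) :
    D.shortArcColor f (.inl (a, .above)) = D.shortArcColor f s := by
  unfold shortArcColor arc
  rw [Quot.sound (r := fun s t : D.ShortArc => ∃ a, D.EndsAt s (a, .above) ∧ t = .inl (a, .above))
    ⟨a, hs, rfl⟩]

/-- At a negative crossing the relation expresses the incoming color through the outgoing one, so
solving for the outgoing color produces the inverse action. -/
theorem shortArcColor_below {D : GaussDiagram} (f : D.FundamentalQuandle →◃ X) {s : D.ShortArc}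
    {a : D.Arrow} (hs : D.EndsAt s (a, .below)) :
    D.shortArcColor f (.inl (a, .below)) =
      (Rack.act' (D.shortArcColor f (.inl (a, .above))) ^ (D.sign a : ℤ))
        (D.shortArcColor f s) := by
  rcases Int.units_eq_one_or (D.sign a) with h | h
  · have := PresentedQuandle.eval_eq_of_rels f (CrossingRel.pos a s h hs)
    simpa [h, QuandleTerm.eval, shortArcColor] using this.symm
  · have := PresentedQuandle.eval_eq_of_rels f (CrossingRel.neg a s h hs)
    simp only [QuandleTerm.eval] at this
    simp [h, shortArcColor, ← this]

/-- The color of the short arc that begins at `e` is the outgoing color at `e`, and also the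
incoming color at the successor of `e`. The relations of the fundamental quandle are then exactly
the crossing rule. -/
theorem nonempty_col_equiv_coloring (X : Type*) [Quandle X] (D : GaussDiagram) :
    Nonempty (D.Col X ≃ D.Coloring (quandleRule X)) := by
  refine nonempty_equiv_of_rel (fun f c =>
    (∀ e, D.shortArcColor f (.inl e) = D.out (quandleRule X) c.1.2 e) ∧
      ∀ j, D.shortArcColor f (.inr j) = c.1.1 j) ?_ ?_ ?_ ?_
  · intro f
    -- `p e` is the predecessor of `e`; the arc beginning there carries the incoming color at `e`.
    choose p hp using D.exists_follows_left
    have key : ∀ e, D.out (quandleRule X) (fun e => D.shortArcColor f (.inl (p e))) e =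
        D.shortArcColor f (.inl e) := by
      have habove : ∀ a : D.Arrow, D.shortArcColor f (.inl (p (a, .above))) =
          D.shortArcColor f (.inl (a, .above)) := fun a =>
        (shortArcColor_above f ⟨_, rfl, hp _⟩).symm
      rintro ⟨a, _ | _⟩
      · exact habove a
      · simp only [out, quandleRule, habove]
        exact (shortArcColor_below f ⟨_, rfl, hp _⟩).symm
    refine ⟨⟨(fun j => if h : D.word j = [] then D.shortArcColor f (.inr ⟨j, h⟩) else
      D.shortArcColor f (.inl (p ((D.word j).head h))), fun e => D.shortArcColor f (.inl (p e))),
      isColoring_of_follows ?_ ?_⟩, ?_, ?_⟩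
    · intro e e' h
      rw [key]
      exact congrArg (fun e => D.shortArcColor f (.inl e)) (h.left_unique (hp e'))
    · intro j e he
      have hj : D.word j ≠ [] := by rintro hj; simp [hj] at he
      simp only [hj, dite_false]
      rw [List.head?_eq_some_head hj] at he
      rw [Option.some.inj he]
    · exact fun e => (key e).symm
    · rintro ⟨j, hj⟩
      simp [hj]
  · rintro ⟨⟨b, i⟩, h⟩
    have hs : ∀ s t : D.ShortArc, (∃ a, D.EndsAt s (a, .above) ∧ t = .inl (a, .above)) →
        Sum.elim (D.out (quandleRule X) i) (fun j => b j.1) s =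
          Sum.elim (D.out (quandleRule X) i) (fun j => b j.1) t := by
      rintro _ _ ⟨a, ⟨e, rfl, he⟩, rfl⟩
      exact h.out_eq he
    refine ⟨PresentedQuandle.lift (Quot.lift _ hs) ?_, fun e => rfl, fun j => rfl⟩
    rintro _ _ (⟨a, _, ha, e, rfl, he⟩ | ⟨a, _, ha, e, rfl, he⟩)
    · have := h.out_eq he
      simp only [QuandleTerm.eval, arc, Sum.elim_inl]
      rw [this]
      simp [out, quandleRule, ha]
    · have := h.out_eq he
      simp only [QuandleTerm.eval, arc, Sum.elim_inl]
      rw [this]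
      simp [out, quandleRule, ha]
  · rintro f f' c ⟨h1, h2⟩ ⟨h1', h2'⟩
    refine PresentedQuandle.hom_ext ?_
    rintro ⟨e | j⟩
    · exact (h1 e).trans (h1' e).symm
    · exact (h2 j).trans (h2' j).symm
  · rintro f ⟨⟨b, i⟩, h⟩ ⟨⟨b', i'⟩, h'⟩ ⟨h1, h2⟩ ⟨h1', h2'⟩
    dsimp only at h h' h1 h2 h1' h2'
    have hi : i = i' := by
      funext e
      obtain ⟨p, hp⟩ := D.exists_follows_left e
      rw [← h.out_eq hp, ← h'.out_eq hp, ← h1, h1']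
    subst hi
    have hb := h.ext h' fun j hj => (h2 ⟨j, hj⟩).symm.trans (h2' ⟨j, hj⟩)
    subst hb
    rfl

end GaussDiagram

/-! ### The action of an automorphism -/

section Rack

variable {X : Type*} [Quandle X]

/-- Self-distributivity: translating the acting element by `w` conjugates its action by that of `w`.
-/
theorem Rack.act'_act'_apply (w y : X) :
    Rack.act' (Rack.act' w y) = Rack.act' w * Rack.act' y * (Rack.act' w)⁻¹ :=
  Rack.ad_conj w y

theorem Rack.act'_act'_inv_apply (w y : X) :
    Rack.act' ((Rack.act' w)⁻¹ y) = (Rack.act' w)⁻¹ * Rack.act' y * Rack.act' w := by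
  have h := Rack.act'_act'_apply w ((Rack.act' w)⁻¹ y)
  rw [← Equiv.Perm.mul_apply, mul_inv_cancel, Equiv.Perm.one_apply] at h
  rw [h]
  group

end Rack

namespace GaussDiagram

variable {X : Type*} {D : GaussDiagram}

/-! ### Colorings of `Zh(D)` -/

open Classical in
/-- The first of the two passages in a block. -/
noncomputable def ZhChoice.first (z : D.ZhChoice) (e : D.End) : (D.Arrow ⊕ D.End) × Pass :=
  if z.Before e then (.inr e, .below) else (.inl e.1, e.2)

open Classical in
/-- The second of the two passages in a block. -/
noncomputable def ZhChoice.second (z : D.ZhChoice) (e : D.End) : (D.Arrow ⊕ D.End) × Pass :=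
  if z.Before e then (.inl e.1, e.2) else (.inr e, .below)

theorem ZhChoice.block_eq (z : D.ZhChoice) (e : D.End) : z.block e = [z.first e, z.second e] := by
  unfold ZhChoice.block ZhChoice.first ZhChoice.second
  split_ifs <;> rfl

theorem ZhChoice.first_or_second (z : D.ZhChoice) (x : (D.Arrow ⊕ D.End) × Pass) :
    (∃ e, x = (.inr e, .above)) ∨ ∃ e, x = z.first e ∨ x = z.second e := by
  obtain ⟨a | e, p⟩ := x
  · refine .inr ⟨(a, p), ?_⟩
    unfold ZhChoice.first ZhChoice.second
    split_ifs <;> simp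
  · cases p with
    | above => exact .inl ⟨e, rfl⟩
    | below =>
      refine .inr ⟨e, ?_⟩
      unfold ZhChoice.first ZhChoice.second
      split_ifs <;> simp

/-- A block behaves like one endpoint, with the incoming color of its first passage and the outgoing
color of its second, subject to matching in between. -/
theorem ZhChoice.traverse_flatMap_block (z : D.ZhChoice) {i o : (D.Arrow ⊕ D.End) × Pass → X}
    {l : List D.End} {x y : X} :
    Traverse i o x (l.flatMap z.block) y ↔
      Traverse (i ∘ z.first) (o ∘ z.second) x l y ∧ ∀ e ∈ l, o (z.first e) = i (z.second e) := by
  induction l generalizing x with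
  | nil => simp
  | cons e l ih =>
    rw [List.flatMap_cons, z.block_eq, List.cons_append, List.cons_append, List.nil_append]
    simp only [traverse_cons, Function.comp_apply, List.forall_mem_cons, ih]
    tauto

/-- Applied to `ω`, which is always on top: its color is the same everywhere. -/
theorem traverse_of_fixed {E : Type*} {i o : E → X} {l : List E}
    (h : ∀ e ∈ l, o e = i e) {x y : X} : Traverse i o x l y ↔ x = y ∧ ∀ e ∈ l, i e = x := by
  induction l generalizing x with
  | nil => simp
  | cons e l ih =>
    rw [traverse_cons, ih fun f hf => h f (by simp [hf]), h e (by simp)]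
    constructor
    · rintro ⟨rfl, rfl, h⟩
      simpa using h
    · rintro ⟨rfl, h⟩
      simp only [List.forall_mem_cons] at h
      exact ⟨h.1.symm, h.1, fun f hf => (h.2 f hf).trans h.1.symm⟩

variable [Quandle X]

/-- The outgoing colors of `Zh(D)` in a quandle coloring. -/
def zhOut (D : GaussDiagram) (i : (D.Arrow ⊕ D.End) × Pass → X)
    (e : (D.Arrow ⊕ D.End) × Pass) : X :=
  quandleRule X (Sum.elim D.sign D.zhSign e.1) e.2 (i (e.1, .above)) (i e)

/-- Incoming colors of `Zh(D)` that fit inside the blocks, where `ω` has the color `w`. -/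
structure IsBlockColoring (z : D.ZhChoice) (w : X) (i : (D.Arrow ⊕ D.End) × Pass → X) : Prop where
  inr_above (e : D.End) : i (.inr e, .above) = w
  out_first (e : D.End) : D.zhOut i (z.first e) = i (z.second e)

/-- The colorings of `Zh(D)` in terms of the blocks. -/
theorem isColoring_zh_iff (z : D.ZhChoice) {b : Option D.Comp → X}
    {i : (D.Arrow ⊕ D.End) × Pass → X} :
    (D.zh z).IsColoring (quandleRule X) b i ↔ IsBlockColoring z (b none) i ∧
      ∀ j : D.Comp, Traverse (i ∘ z.first) (D.zhOut i ∘ z.second)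
        (b (some j)) (D.word j) (b (some j)) := by
  have hnone : Traverse i (D.zhOut i) (b none)
      (z.order.map fun e => (.inr e, .above)) (b none) ↔
      ∀ e : D.End, i (.inr e, .above) = b none := by
    rw [traverse_of_fixed]
    · constructor
      · exact fun h e => h.2 _ (List.mem_map.2 ⟨e, z.mem_order e, rfl⟩)
      · refine fun h => ⟨rfl, fun e he => ?_⟩
        obtain ⟨e, -, rfl⟩ := List.mem_map.1 he
        exact h e
    · intro e he
      obtain ⟨e, -, rfl⟩ := List.mem_map.1 he
      rfl
  constructor
  · intro h
    refine ⟨⟨hnone.1 (h none), fun e => ?_⟩,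
      fun j => (z.traverse_flatMap_block.1 (h (some j))).1⟩
    obtain ⟨j, hj, -⟩ := D.existsUnique_comp e
    exact (z.traverse_flatMap_block.1 (h (some j))).2 e hj
  · rintro ⟨h, h'⟩ (_ | j)
    · exact hnone.2 h.inr_above
    · exact z.traverse_flatMap_block.2 ⟨h' j, fun e _ => h.out_first e⟩

theorem IsBlockColoring.inl_above {z : D.ZhChoice} {w : X} {i : (D.Arrow ⊕ D.End) × Pass → X}
    (h : IsBlockColoring z w i) {a : D.Arrow} (ha : z.overFirst a) :
    i (.inl a, .above) = (Rack.act' w ^ (-(D.sign a : ℤ))) (i (z.first (a, .above))) := by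
  have h1 := h.out_first (a, .above)
  simp only [ZhChoice.first, ZhChoice.second, ZhChoice.Before, ha, if_true] at h1 ⊢
  rw [← h1]
  simp only [zhOut, quandleRule, h.inr_above, zhSign, Sum.elim_inr, Units.val_neg]

/-- If `ω` meets the over-strand first, the under-strand is acted on by `(w^(-s) y)^s = w^(-s) y^s
w^s` and then by `w^s`, in total by `y^s w^s`. In the other picture it is acted on by `w^s` and then
by `y^s`, which is the same. -/
theorem IsBlockColoring.out_second {z : D.ZhChoice} {w : X} {i : (D.Arrow ⊕ D.End) × Pass → X}
    (h : IsBlockColoring z w i) (e : D.End) :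
    D.zhOut i (z.second e) = D.out (zhRule w) (i ∘ z.first) e := by
  have h1 := h.out_first e
  obtain ⟨a, _ | _⟩ := e <;> by_cases ha : z.overFirst a
  · simp only [ZhChoice.second, ZhChoice.Before, ha, if_true]
    simp only [zhOut, quandleRule, Equiv.Perm.one_apply, h.inl_above ha, out, zhRule,
      Function.comp_apply]
  · simp only [ZhChoice.first, ZhChoice.second, ZhChoice.Before, ha, if_false] at h1 ⊢
    simp only [zhOut, quandleRule, Equiv.Perm.one_apply] at h1
    simp only [zhOut, out, zhRule, quandleRule, Function.comp_apply, h.inr_above, ← h1, zhSign,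
      Sum.elim_inr, Units.val_neg, ZhChoice.first, ZhChoice.Before, ha, if_false]
  · have h' := h.inl_above ha
    simp only [ZhChoice.first, ZhChoice.second, ZhChoice.Before, ha, not_true_eq_false, if_true,
      if_false] at h1 h' ⊢
    simp only [zhOut, quandleRule, Sum.elim_inl, h'] at h1
    simp only [zhOut, out, zhRule, quandleRule, Function.comp_apply, h.inr_above, ← h1, zhSign,
      Sum.elim_inr, ZhChoice.first, ZhChoice.Before, ha, if_true, if_false, not_true_eq_false,
      ← Equiv.Perm.mul_apply]
    congr 1
    rcases Int.units_eq_one_or (D.sign a) with hs | hs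
    · simp only [hs, Units.val_one, zpow_one, zpow_neg, Rack.act'_act'_inv_apply]
      group
    · simp only [hs, Units.val_neg, Units.val_one, zpow_one, zpow_neg, neg_neg,
        Rack.act'_act'_apply]
      group
  · simp only [ZhChoice.first, ZhChoice.second, ZhChoice.Before, ha, not_false_eq_true, if_true]
      at h1 ⊢
    simp only [zhOut, quandleRule, h.inr_above, zhSign, Sum.elim_inr] at h1
    simp only [zhOut, out, zhRule, quandleRule, Function.comp_apply, ← h1,
      Sum.elim_inl, ZhChoice.first, ZhChoice.Before, ha, if_true, if_false, not_false_eq_true,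
      Equiv.Perm.mul_apply]

theorem IsBlockColoring.ext {z : D.ZhChoice} {w : X} {i i' : (D.Arrow ⊕ D.End) × Pass → X}
    (h : IsBlockColoring z w i) (h' : IsBlockColoring z w i') (hi : i ∘ z.first = i' ∘ z.first) :
    i = i' := by
  have hf : ∀ e, i (z.first e) = i' (z.first e) := congrFun hi
  have habove : ∀ s, i (s, .above) = i' (s, .above) := by
    rintro (a | e)
    · by_cases ha : z.overFirst a
      · rw [h.inl_above ha, h'.inl_above ha, hf]
      · simpa [ZhChoice.first, ZhChoice.Before, ha] using hf (a, .above)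
    · rw [h.inr_above, h'.inr_above]
  funext x
  rcases z.first_or_second x with ⟨e, rfl⟩ | ⟨e, rfl | rfl⟩
  · exact habove _
  · exact hf e
  · rw [← h.out_first, ← h'.out_first]
    simp only [zhOut, habove, hf]

theorem exists_isBlockColoring (z : D.ZhChoice) (w : X) (k : D.End → X) :
    ∃ i, IsBlockColoring z w i ∧ i ∘ z.first = k := by
  classical
  -- A first passage receives the prescribed color, a second one the color that leaves the first. In
  -- the branch `overFirst`, the under-strand meets an over-strand already shifted by `w`.
  refine ⟨fun
    | (.inr _, .above) => w
    | (.inr (a, .above), .below) => k (a, .above)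
    | (.inr (a, .below), .below) => if z.overFirst a then
        (Rack.act' ((Rack.act' w ^ (-(D.sign a : ℤ))) (k (a, .above))) ^ (D.sign a : ℤ))
          (k (a, .below)) else k (a, .below)
    | (.inl a, .above) => if z.overFirst a then
        (Rack.act' w ^ (-(D.sign a : ℤ))) (k (a, .above)) else k (a, .above)
    | (.inl a, .below) => if z.overFirst a then k (a, .below) else
        (Rack.act' w ^ (D.sign a : ℤ)) (k (a, .below)), ⟨fun e => rfl, ?_⟩, ?_⟩
  · rintro ⟨a, _ | _⟩ <;> by_cases ha : z.overFirst a <;>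
      simp [ZhChoice.first, ZhChoice.second, ZhChoice.Before, ha, zhOut, quandleRule, zhSign]
  · funext e
    obtain ⟨a, _ | _⟩ := e <;> by_cases ha : z.overFirst a <;>
      simp [ZhChoice.first, ZhChoice.Before, ha]

/-- The colorings are sorted by the color `w` of `ω`; the incoming colors of the blocks then
determine everything else. -/
theorem nonempty_coloring_zh_equiv (X : Type*) [Quandle X] (z : D.ZhChoice) :
    Nonempty ((D.zh z).Coloring (quandleRule X) ≃ Σ w : X, D.Coloring (zhRule w)) := by
  refine nonempty_equiv_of_rel (fun c d => c.1.1 none = d.1 ∧ (∀ j, c.1.1 (some j) = d.2.1.1 j) ∧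
    c.1.2 ∘ z.first = d.2.1.2) ?_ ?_ ?_ ?_
  · rintro ⟨⟨b, i⟩, h⟩
    obtain ⟨h1, h2⟩ := (isColoring_zh_iff z).1 h
    refine ⟨⟨b none, ⟨(fun j => b (some j), i ∘ z.first), fun j => ?_⟩⟩, rfl, fun j => rfl, rfl⟩
    have := h2 j
    rwa [funext (f := D.zhOut i ∘ z.second) h1.out_second] at this
  · rintro ⟨w, ⟨⟨b, k⟩, h⟩⟩
    obtain ⟨i, hi, rfl⟩ := exists_isBlockColoring z w k
    refine ⟨⟨(fun j => j.elim w b, i), (isColoring_zh_iff z).2 ⟨hi, fun j => ?_⟩⟩, rfl,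
      fun j => rfl, rfl⟩
    rw [funext (f := D.zhOut i ∘ z.second) hi.out_second]
    exact h j
  · rintro ⟨⟨b, i⟩, h⟩ ⟨⟨b', i'⟩, h'⟩ ⟨w, ⟨⟨c, k⟩, hk⟩⟩ ⟨hw, hb, hi⟩ ⟨hw', hb', hi'⟩
    dsimp only at h h' hw hb hi hw' hb' hi'
    have hbb : b = b' := by
      funext j
      cases j with
      | none => exact hw.trans hw'.symm
      | some j => exact (hb j).trans (hb' j).symm
    subst hbb
    have hii := ((isColoring_zh_iff z).1 h).1.ext ((isColoring_zh_iff z).1 h').1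
      (hi.trans hi'.symm)
    subst hii
    rfl
  · rintro ⟨⟨b, i⟩, h⟩ ⟨w, ⟨⟨c, k⟩, hk⟩⟩ ⟨w', ⟨⟨c', k'⟩, hk'⟩⟩ ⟨hw, hb, hi⟩ ⟨hw', hb', hi'⟩
    dsimp only at hw hb hi hw' hb' hi'
    obtain rfl := hw.symm.trans hw'
    obtain rfl : c = c' := funext fun j => (hb j).symm.trans (hb' j)
    obtain rfl := hi.symm.trans hi'
    rfl

end GaussDiagram

namespace GaussDiagram

/-! ### Isomorphic diagrams -/

theorem Iso.symm {D D' : GaussDiagram} (h : D.Iso D') : D'.Iso D := by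
  obtain ⟨c, φ, hs, hw⟩ := h
  refine ⟨c.symm, φ.symm, fun a => ?_, fun j => ?_⟩
  · rw [← hs, φ.apply_symm_apply]
  · have := ((hw (c.symm j)).map (Prod.map φ.symm id)).symm
    rw [c.apply_symm_apply, List.map_map, Prod.map_comp_map, φ.symm_comp_self] at this
    simpa using this

variable {X : Type*}

/-- Colorings are pulled back along the isomorphism. Base colors are recomputed from the incoming
colors, because words correspond only up to rotation. -/
theorem Iso.card_coloring_le [Finite X] {D D' : GaussDiagram} (h : D.Iso D') (K : CrossingRule X) :
    Nat.card (D'.Coloring K) ≤ Nat.card (D.Coloring K) := by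
  obtain ⟨c, φ, hs, hw⟩ := h
  set ψ : D.End → D'.End := Prod.map φ id
  have hψ : ψ.Surjective := φ.surjective.prodMap Function.surjective_id
  have hfollows : ∀ e f, D.Follows e f → D'.Follows (ψ e) (ψ f) := by
    rintro e f ⟨j, l, hl, he, hf⟩
    exact ⟨c j, l.map ψ, (hw j).symm.trans (hl.map ψ), by simp [he], by simp [hf]⟩
  have hnil : ∀ j, D'.word (c j) = [] → D.word j = [] := by
    intro j hj
    have := hw j
    rwa [hj, List.isRotated_nil_iff, List.map_eq_nil_iff] at this
  refine GaussDiagram.card_coloring_le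
    (fun b' i' b i => i = i' ∘ ψ ∧ ∀ j, D.word j = [] → b j = b' (c j)) ?_ ?_
  · intro b' i' h
    refine ⟨_, i' ∘ ψ, isColoring_baseColor (b' ∘ c) fun e f hef => ?_, rfl,
      fun j hj => baseColor_of_nil _ _ hj⟩
    rw [Function.comp_apply, ← h.out_eq (hfollows e f hef)]
    simp only [out, ← hs]
    rfl
  · rintro b₁ i₁ b₂ i₂ b i h₁ h₂ h ⟨rfl, hb⟩ ⟨hi, hb'⟩
    obtain rfl := hψ.injective_comp_right hi
    refine ⟨h₁.ext h₂ fun j hj => ?_, rfl⟩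
    obtain ⟨j, rfl⟩ := c.surjective j
    rw [← hb j (hnil j hj), ← hb' j (hnil j hj)]

theorem Iso.card_coloring_eq [Finite X] {D D' : GaussDiagram} (h : D.Iso D') (K : CrossingRule X) :
    Nat.card (D.Coloring K) = Nat.card (D'.Coloring K) :=
  le_antisymm (h.symm.card_coloring_le K) (h.card_coloring_le K)

/-- The same diagram with other base points. -/
def reword (D : GaussDiagram) (W : D.Comp → List D.End) (h : ∀ j, D.word j ~r W j) :
    GaussDiagram where
  Comp := D.Comp
  Arrow := D.Arrow
  finite_comp := D.finite_comp
  finite_arrow := D.finite_arrow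
  sign := D.sign
  word := W
  nodup j := (h j).nodup_iff.1 (D.nodup j)
  existsUnique_comp e := by simpa only [(h _).mem_iff] using D.existsUnique_comp e

theorem reword_iso (D : GaussDiagram) (W : D.Comp → List D.End) (h : ∀ j, D.word j ~r W j) :
    D.Iso (D.reword W h) :=
  ⟨Equiv.refl _, Equiv.refl _, fun _ => rfl, fun j => by
    have : (D.word j).map (Prod.map id id) ~r W j := by simpa using h j
    exact this⟩

theorem delete_reword_iso (D : GaussDiagram) (W : D.Comp → List D.End) (h : ∀ j, D.word j ~r W j)
    (S : Set D.Arrow) : (D.delete S).Iso ((D.reword W h).delete S) :=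
  ⟨Equiv.refl _, Equiv.refl _, fun _ => rfl, fun j => by
    have : ((D.delete S).word j).map (Prod.map id id) ~r (D.delete S).word j := by
      simpa using List.IsRotated.refl _
    exact this.trans ((h j).filterMap _)⟩

/-! ### Erasing arrows -/

section Delete

variable {D : GaussDiagram} {S : Set D.Arrow}

/-- The endpoints of the remaining arrows as endpoints of the original diagram. -/
def inclusion (D : GaussDiagram) (S : Set D.Arrow) (e : {a : D.Arrow // a ∉ S} × Pass) : D.End :=
  (e.1.1, e.2)

open Classical in
/-- The partial inverse of the inclusion of the remaining endpoints. -/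
noncomputable def restrict (D : GaussDiagram) (S : Set D.Arrow) (e : D.End) :
    Option ({a : D.Arrow // a ∉ S} × Pass) :=
  if h : e.1 ∉ S then some (⟨e.1, h⟩, e.2) else none

theorem restrict_of_mem {e : D.End} (h : e.1 ∈ S) : D.restrict S e = none := by
  simp [restrict, h]

theorem restrict_of_notMem {e : D.End} (h : e.1 ∉ S) :
    D.restrict S e = some (⟨e.1, h⟩, e.2) := by
  simp [restrict, h]

theorem out_congr {K : CrossingRule X} {i i' : D.End → X} {e : D.End}
    (h : i (e.1, .above) = i' (e.1, .above)) (he : i e = i' e) : D.out K i e = D.out K i' e := by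
  simp only [out, h, he]

/-- A list of endpoints is balanced if the endpoints of arrows in `S` come in adjacent pairs that
are related by `P`. -/
inductive Balanced (S : Set D.Arrow) (P : D.End → D.End → Prop) : List D.End → Prop
  | nil : Balanced S P []
  | cons {e l} : e.1 ∉ S → Balanced S P l → Balanced S P (e :: l)
  | pair {x y l} : P x y → Balanced S P l → Balanced S P (x :: y :: l)

/-- `P` relates the two endpoints in which a strand passes through a pair of crossings that is
erased by a Reidemeister move. -/
structure IsPairing (S : Set D.Arrow) (P : D.End → D.End → Prop) : Prop where
  left_mem {x y} : P x y → x.1 ∈ S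
  right_mem {x y} : P x y → y.1 ∈ S
  disjoint {x y z} : P x y → ¬ P y z
  follows {x y} : P x y → D.Follows x y

variable {P : D.End → D.End → Prop} {i o : D.End → X}

theorem Balanced.of_forall_notMem {l : List D.End} (h : ∀ e ∈ l, e.1 ∉ S) : Balanced S P l := by
  induction l with
  | nil => exact .nil
  | cons e l ih => exact .cons (h e (by simp)) (ih fun f hf => h f (by simp [hf]))

theorem Balanced.append {l l' : List D.End} (h : Balanced S P l) (h' : Balanced S P l') :
    Balanced S P (l ++ l') := by
  induction h with
  | nil => exact h'
  | cons he _ ih => exact .cons he ih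
  | pair hP _ ih => exact .pair hP ih

theorem Balanced.traverse_restrict (hP : IsPairing S P) {l : List D.End} (h : Balanced S P l)
    (ho : ∀ x y, P x y → o y = i x) {p q : X} (hl : Traverse i o p l q) :
    Traverse (i ∘ D.inclusion S) (o ∘ D.inclusion S) p
      (l.filterMap (D.restrict S)) q := by
  induction h generalizing p with
  | nil => exact hl
  | cons he _ ih =>
    rw [List.filterMap_cons_some (restrict_of_notMem he)]
    exact ⟨hl.1, ih hl.2⟩
  | @pair x y l hxy _ ih =>
    rw [List.filterMap_cons_none (restrict_of_mem (hP.left_mem hxy)),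
      List.filterMap_cons_none (restrict_of_mem (hP.right_mem hxy))]
    obtain ⟨rfl, -, h⟩ := hl
    rw [ho x y hxy] at h
    exact ih h

/-- `m` records the color with which the strand arrives at each erased pair. It is found from the
reduced word alone, before the colors at the erased endpoints are chosen, and serves as the
prescription for them. -/
theorem Balanced.exists_traverse (hP : IsPairing S P) {l : List D.End} (h : Balanced S P l)
    (hl : l.Nodup) {i' o' : {a : D.Arrow // a ∉ S} × Pass → X} {p q : X}
    (h' : Traverse i' o' p (l.filterMap (D.restrict S)) q) :
    ∃ m : D.End → X, ∀ i o : D.End → X, i ∘ D.inclusion S = i' → o ∘ D.inclusion S = o' →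
      (∀ x y, P x y → x ∈ l → i x = m x ∧ o x = i y ∧ o y = i x) → Traverse i o p l q := by
  classical
  induction h generalizing p with
  | nil => exact ⟨fun _ => p, fun i o _ _ _ => h'⟩
  | @cons e l he _ ih =>
    rw [List.filterMap_cons_some (restrict_of_notMem he)] at h'
    obtain ⟨m, hm⟩ := ih hl.of_cons h'.2
    refine ⟨m, fun i o hi ho hxy => ⟨h'.1.trans ?_, ?_⟩⟩
    · rw [← hi]
      rfl
    · have := hm i o hi ho fun x y h hx => hxy x y h (List.mem_cons_of_mem _ hx)
      rw [← ho] at this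
      exact this
  | @pair x y l hxy _ ih =>
    rw [List.filterMap_cons_none (restrict_of_mem (hP.left_mem hxy)),
      List.filterMap_cons_none (restrict_of_mem (hP.right_mem hxy))] at h'
    obtain ⟨m, hm⟩ := ih hl.of_cons.of_cons h'
    -- As the list has no repetitions, `x` does not recur, so the update leaves later pairs alone.
    refine ⟨Function.update m x p, fun i o hi ho h => ?_⟩
    obtain ⟨h1, h2, h3⟩ := h x y hxy (by simp)
    rw [Function.update_self] at h1
    refine ⟨h1.symm, h2, ?_⟩
    rw [h3, h1]
    refine hm i o hi ho fun x' y' hx'y' hx' => ?_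
    have := h x' y' hx'y' (by simp [hx'])
    rwa [Function.update_of_ne] at this
    rintro rfl
    simp [hx'] at hl

/-- Both strands start with the same color, agree after each remaining endpoint and return to their
color after each pair, so they arrive at every pair with equal colors. -/
theorem Balanced.incoming_unique (hP : IsPairing S P) {l : List D.End} (h : Balanced S P l)
    {i' o' : D.End → X} (hi : ∀ e, e.1 ∉ S → o e = o' e)
    (ho : ∀ x y, P x y → o y = i x) (ho' : ∀ x y, P x y → o' y = i' x) {p q q' : X}
    (hl : Traverse i o p l q) (hl' : Traverse i' o' p l q') {x y : D.End} (hxy : P x y)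
    (hx : x ∈ l) : i x = i' x := by
  induction h generalizing p with
  | nil => simp at hx
  | @cons e l he _ ih =>
    rcases List.mem_cons.1 hx with rfl | hx
    · exact absurd (hP.left_mem hxy) he
    · have h2 := hl'.2
      rw [← hi e he] at h2
      exact ih hl.2 h2 hx
  | @pair x' y' l hxy' _ ih =>
    obtain ⟨h1, -, h2⟩ := hl
    obtain ⟨h1', -, h2'⟩ := hl'
    rcases List.mem_cons.1 hx with rfl | hx
    · exact h1.symm.trans h1'
    rcases List.mem_cons.1 hx with rfl | hx
    · exact absurd hxy (hP.disjoint hxy')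
    rw [ho _ _ hxy', ← h1] at h2
    rw [ho' _ _ hxy', ← h1'] at h2'
    exact ih h2 h2' hx

/-- `cancel` says that a pair restores the color of its strand. `extend` lets the colors arriving at
the pairs be prescribed, and `unique` says that these and the colors off `S` determine the coloring.
-/
theorem card_coloring_delete_of_balanced [Finite X] (hP : IsPairing S P)
    (hbal : ∀ j, Balanced S P (D.word j)) (K : CrossingRule X)
    (cancel : ∀ i, (∀ x y, P x y → D.out K i x = i y) → ∀ x y, P x y → D.out K i y = i x)
    (extend : ∀ m i₀ : D.End → X, ∃ i, (∀ e, e.1 ∉ S → i e = i₀ e) ∧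
      ∀ x y, P x y → i x = m x ∧ D.out K i x = i y)
    (unique : ∀ i i' : D.End → X, (∀ e, e.1 ∉ S → i e = i' e) →
      (∀ x y, P x y → i x = i' x ∧ D.out K i x = i y ∧ D.out K i' x = i' y) → i = i') :
    Nat.card (D.Coloring K) = Nat.card ((D.delete S).Coloring K) := by
  refine le_antisymm (GaussDiagram.card_coloring_le
    (fun b i b' i' => b' = b ∧ i' = i ∘ D.inclusion S) ?_ ?_) (GaussDiagram.card_coloring_le
    (fun b' i' b i => b' = b ∧ i' = i ∘ D.inclusion S) ?_ ?_)
  · intro b i h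
    exact ⟨b, i ∘ D.inclusion S, fun j => (hbal j).traverse_restrict hP
      (cancel i fun x y hxy => h.out_eq (hP.follows hxy)) (h j), rfl, rfl⟩
  · rintro b i b₂ i₂ b' i' h h₂ - ⟨rfl, rfl⟩ ⟨rfl, hi⟩
    have hoff : ∀ e, e.1 ∉ S → i e = i₂ e := fun e he =>
      congrFun hi (⟨e.1, he⟩, e.2)
    have hout : ∀ e, e.1 ∉ S → D.out K i e = D.out K i₂ e := fun e he =>
      out_congr (hoff _ he) (hoff e he)
    have hf := fun x y (hxy : P x y) => h.out_eq (hP.follows hxy)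
    have hf₂ := fun x y (hxy : P x y) => h₂.out_eq (hP.follows hxy)
    refine ⟨rfl, unique i i₂ hoff fun x y hxy => ⟨?_, hf x y hxy, hf₂ x y hxy⟩⟩
    obtain ⟨j, hj, -⟩ := D.existsUnique_comp x
    exact (hbal j).incoming_unique hP hout (cancel i hf) (cancel i₂ hf₂) (h j) (h₂ j) hxy hj
  · intro b i' h
    choose m hm using fun j => (hbal j).exists_traverse hP (D.nodup j) (h j)
    choose comp hcomp using fun e => (D.existsUnique_comp e).exists
    classical
    -- A color is needed as a filler at the erased endpoints. If there is none, the existence of `b`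
    -- leaves no circles at all.
    rcases isEmpty_or_nonempty X with hX | ⟨⟨x₀⟩⟩
    · have : IsEmpty D.Comp := ⟨fun j => hX.false (b j)⟩
      have : IsEmpty D.End := ⟨fun e => isEmptyElim (comp e)⟩
      exact ⟨b, isEmptyElim, fun j => isEmptyElim j, rfl, funext fun e =>
        isEmptyElim (D.inclusion S e)⟩
    obtain ⟨i, hi, hiP⟩ := extend (fun e => m (comp e) e)
      (fun e => if he : e.1 ∉ S then i' (⟨e.1, he⟩, e.2) else x₀)
    have hi' : i ∘ D.inclusion S = i' := by
      funext e
      exact (hi (D.inclusion S e) e.1.2).trans (dif_pos e.1.2)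
    refine ⟨b, i, fun j => hm j i _ hi' ?_ fun x y hxy hx => ?_, rfl, hi'.symm⟩
    · rw [← hi']
      rfl
    · refine ⟨?_, (hiP x y hxy).2, cancel i (fun x y hxy => (hiP x y hxy).2) x y hxy⟩
      rw [(hiP x y hxy).1, D.word_injective (hcomp x) hx]
  · rintro b i b₂ i₂ b' i' - - - ⟨rfl, rfl⟩ ⟨rfl, rfl⟩
    exact ⟨rfl, rfl⟩

theorem Follows.reword {W : D.Comp → List D.End} {h : ∀ j, D.word j ~r W j} {e f : D.End}
    (hef : D.Follows e f) : (D.reword W h).Follows e f := by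
  obtain ⟨j, l, hl, he, hf⟩ := hef
  exact ⟨j, l, (h j).symm.trans hl, he, hf⟩

/-- Base points are moved first, so that none of them separates the two endpoints of a pair. -/
theorem card_coloring_delete [Finite X] (hP : IsPairing S P)
    (hbal : ∀ j, ∃ l, D.word j ~r l ∧ Balanced S P l) (K : CrossingRule X)
    (cancel : ∀ i, (∀ x y, P x y → D.out K i x = i y) → ∀ x y, P x y → D.out K i y = i x)
    (extend : ∀ m i₀ : D.End → X, ∃ i, (∀ e, e.1 ∉ S → i e = i₀ e) ∧
      ∀ x y, P x y → i x = m x ∧ D.out K i x = i y)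
    (unique : ∀ i i' : D.End → X, (∀ e, e.1 ∉ S → i e = i' e) →
      (∀ x y, P x y → i x = i' x ∧ D.out K i x = i y ∧ D.out K i' x = i' y) → i = i') :
    Nat.card (D.Coloring K) = Nat.card ((D.delete S).Coloring K) := by
  choose W hW hbal using hbal
  rw [(D.reword_iso W hW).card_coloring_eq, (D.delete_reword_iso W hW S).card_coloring_eq]
  have hbal' : ∀ j, Balanced (D := D.reword W hW) S P ((D.reword W hW).word j) := by
    intro j
    change Balanced (D := D.reword W hW) S P (W j)
    have h := hbal j
    generalize W j = l at h ⊢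
    induction h with
    | nil => exact .nil
    | cons h _ ih => exact .cons h ih
    | pair h _ ih => exact .pair h ih
  exact card_coloring_delete_of_balanced (D := D.reword W hW) (P := P)
    ⟨hP.left_mem, hP.right_mem, hP.disjoint, fun h => (hP.follows h).reword⟩ hbal' K cancel extend
      unique

end Delete

end GaussDiagram

namespace GaussDiagram

variable {X : Type*} {D : GaussDiagram}

/-! ### Balanced words from adjacent endpoints -/

theorem Follows.mem_iff {e f : D.End} (h : D.Follows e f) (j : D.Comp) :
    e ∈ D.word j ↔ f ∈ D.word j := by
  obtain ⟨k, l, he, hf, -⟩ := h.exists_rotation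
  exact ⟨fun hj => D.word_injective hj he ▸ hf, fun hj => D.word_injective hj hf ▸ he⟩

theorem Follows.exists_word_isRotated {e f : D.End} (h : D.Follows e f) (hef : e ≠ f) {j : D.Comp}
    (hj : e ∈ D.word j) : ∃ t, D.word j ~r e :: f :: t := by
  obtain ⟨k, l, hk, -, hl, he, hf⟩ := h.exists_rotation
  obtain rfl := D.word_injective hj hk
  rcases l with _ | ⟨f', l⟩
  · simp at hf
  obtain rfl : f' = f := by simpa using hf
  rcases List.eq_nil_or_concat l with rfl | ⟨t, e', rfl⟩
  · exact absurd (by simpa using he) hef.symm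
  rw [List.concat_eq_append] at hl he
  obtain rfl : e' = e := by
    rw [← List.cons_append, List.getLast?_concat] at he
    exact Option.some.inj he
  exact ⟨t, hl.trans (List.isRotated_append (l := f' :: t) (l' := [e']))⟩

section Balanced

variable {S : Set D.Arrow} {P : D.End → D.End → Prop}

theorem exists_balanced_of_pair {x y : D.End} (h : D.Follows x y) (hxy : x ≠ y) (hP : P x y)
    {j : D.Comp} (hS : ∀ e ∈ D.word j, e.1 ∈ S → e = x ∨ e = y) :
    ∃ l, D.word j ~r l ∧ Balanced S P l := by
  by_cases hj : x ∈ D.word j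
  · obtain ⟨t, ht⟩ := h.exists_word_isRotated hxy hj
    refine ⟨_, ht, .pair hP (.of_forall_notMem fun e he heS => ?_)⟩
    have hn := ht.nodup_iff.1 (D.nodup j)
    rcases hS e (ht.mem_iff.2 (by simp [he])) heS with rfl | rfl <;> simp [he] at hn
  · refine ⟨_, .refl _, .of_forall_notMem fun e he heS => ?_⟩
    rcases hS e he heS with rfl | rfl
    · exact hj he
    · exact hj ((h.mem_iff j).2 he)

theorem exists_balanced_of_pairs {x y x' y' : D.End} (h : D.Follows x y) (h' : D.Follows x' y')
    (hxy : x ≠ y) (hxy' : x' ≠ y') (hxx' : x ≠ x') (hyx' : y ≠ x') (hxy'' : x ≠ y')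
    (hP : P x y) (hP' : P x' y')
    (hS : ∀ e : D.End, e.1 ∈ S → e = x ∨ e = y ∨ e = x' ∨ e = y') (j : D.Comp) :
    ∃ l, D.word j ~r l ∧ Balanced S P l := by
  by_cases hj : x ∈ D.word j
  swap
  · refine exists_balanced_of_pair h' hxy' hP' fun e he heS => ?_
    rcases hS e heS with rfl | rfl | h1 | h1
    · exact absurd he hj
    · exact absurd ((h.mem_iff j).2 he) hj
    · exact .inl h1
    · exact .inr h1
  by_cases hj' : x' ∈ D.word j
  swap
  · refine exists_balanced_of_pair h hxy hP fun e he heS => ?_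
    rcases hS e heS with h1 | h1 | rfl | rfl
    · exact .inl h1
    · exact .inr h1
    · exact absurd he hj'
    · exact absurd ((h'.mem_iff j).2 he) hj'
  obtain ⟨t, ht⟩ := h.exists_word_isRotated hxy hj
  have hn := ht.nodup_iff.1 (D.nodup j)
  have hx't : x' ∈ t := by
    have := ht.mem_iff.1 hj'
    simpa [hxx'.symm, hyx'.symm] using this
  obtain ⟨u, v, rfl⟩ := List.append_of_mem hx't
  rcases v with _ | ⟨f, v⟩
  -- If `x'` came last in this rotation, its successor would be `x`, which is not `y'`.
  · refine absurd (h'.right_unique ⟨j, _, ht, ?_, rfl⟩) hxy''.symm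
    rw [← List.cons_append, ← List.cons_append, List.getLast?_concat]
  obtain rfl : f = y' :=
    Follows.right_unique (D.follows_of_rotated_append (u := x :: y :: u) ht) h'
  refine ⟨_, ht, .pair hP (.append (.of_forall_notMem fun e he heS => ?_)
    (.pair hP' (.of_forall_notMem fun e he heS => ?_)))⟩ <;>
  · rcases hS e heS with rfl | rfl | rfl | rfl <;>
      grind [List.nodup_append]

/-- The outgoing color at `x` does not depend on the color at `y`, since `y` is neither `x` nor the
tail of the arrow of `x`. -/
theorem exists_extend_pair (K : CrossingRule X) {x y : D.End} (hxy : y ≠ x)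
    (hxy' : y ≠ (x.1, .above)) (m : X) (i₀ : D.End → X) :
    ∃ i, (∀ e, e ≠ x → e ≠ y → i e = i₀ e) ∧ i x = m ∧ D.out K i x = i y := by
  classical
  refine ⟨Function.update (Function.update i₀ x m) y
    (D.out K (Function.update i₀ x m) x), fun e hx hy => ?_, ?_, ?_⟩
  · rw [Function.update_of_ne hy, Function.update_of_ne hx]
  · rw [Function.update_of_ne hxy.symm, Function.update_self]
  · rw [Function.update_self]
    exact out_congr (Function.update_of_ne hxy'.symm _ _) (Function.update_of_ne hxy.symm _ _)

end Balanced

variable [Quandle X]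

/-! ### The first Reidemeister move -/

theorem act'_zpow_self (s : ℤˣ) (y : X) : (Rack.act' y ^ (s : ℤ)) y = y := by
  rcases Int.units_eq_one_or s with rfl | rfl <;> simp

theorem act'_zpow_eq_self_iff (s : ℤˣ) (x y : X) : (Rack.act' y ^ (s : ℤ)) x = y ↔ x = y := by
  conv_lhs => rhs; rw [← act'_zpow_self s y]
  exact (Rack.act' y ^ (s : ℤ)).injective.eq_iff

theorem out_above (w : X) (i : D.End → X) (a : D.Arrow) :
    D.out (zhRule w) i (a, .above) = (Rack.act' w ^ (-(D.sign a : ℤ))) (i (a, .above)) := rfl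

theorem out_below (w : X) (i : D.End → X) (a : D.Arrow) :
    D.out (zhRule w) i (a, .below) = (Rack.act' (i (a, .above)) ^ (D.sign a : ℤ))
      ((Rack.act' w ^ (D.sign a : ℤ)) (i (a, .below))) := rfl

/-- In a kink entered along the under-strand, the over-color occurs on both sides of the equation.
Since an element fixes itself, the equation still has exactly one solution. -/
theorem out_below_eq_above_iff (w : X) (i : D.End → X) (a : D.Arrow) :
    D.out (zhRule w) i (a, .below) = i (a, .above) ↔
      i (a, .above) = (Rack.act' w ^ (D.sign a : ℤ)) (i (a, .below)) := by
  rw [out_below, act'_zpow_eq_self_iff, eq_comm]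

theorem end_eq_or {e : D.End} {a : D.Arrow} (h : e.1 = a) :
    e = (a, .above) ∨ e = (a, .below) := by
  obtain ⟨_, _ | _⟩ := e <;> subst h
  · exact .inl rfl
  · exact .inr rfl

theorem card_coloring_omega1 [Finite X] (w : X) (a : D.Arrow)
    (h : D.Follows (a, .above) (a, .below) ∨ D.Follows (a, .below) (a, .above)) :
    Nat.card (D.Coloring (zhRule w)) = Nat.card ((D.delete {a}).Coloring (zhRule w)) := by
  classical
  rcases h with h | h
  · refine card_coloring_delete (P := fun x y => x = (a, .above) ∧ y = (a, .below))
      ⟨?_, ?_, ?_, ?_⟩ (fun j => ?_) _ ?_ ?_ ?_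
    · rintro _ _ ⟨rfl, rfl⟩; rfl
    · rintro _ _ ⟨rfl, rfl⟩; rfl
    · rintro _ _ _ ⟨rfl, rfl⟩ ⟨h, -⟩; simp at h
    · rintro _ _ ⟨rfl, rfl⟩; exact h
    · exact exists_balanced_of_pair h (by simp) ⟨rfl, rfl⟩ fun e _ he => end_eq_or he
    · rintro i hi _ _ ⟨rfl, rfl⟩
      rw [out_below, ← hi _ _ ⟨rfl, rfl⟩, out_above, ← Equiv.Perm.mul_apply (Rack.act' w ^ _),
        ← zpow_add, add_neg_cancel, zpow_zero, Equiv.Perm.one_apply, act'_zpow_self]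
    · intro m i₀
      refine ⟨Function.update (Function.update i₀ (a, .above) (m (a, .above))) (a, .below)
        ((Rack.act' w ^ (-(D.sign a : ℤ))) (m (a, .above))), fun e he => ?_, ?_⟩
      · rw [Function.update_of_ne, Function.update_of_ne] <;> rintro rfl <;> exact he rfl
      · rintro _ _ ⟨rfl, rfl⟩
        simp [out_above]
    · intro i i' hoff hon
      obtain ⟨h1, h2, h3⟩ := hon _ _ ⟨rfl, rfl⟩
      funext e
      by_cases he : e.1 = a
      · rcases end_eq_or he with rfl | rfl
        · exact h1
        · rw [← h2, ← h3, out_above, out_above, h1]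
      · exact hoff e he
  · refine card_coloring_delete (P := fun x y => x = (a, .below) ∧ y = (a, .above))
      ⟨?_, ?_, ?_, ?_⟩ (fun j => ?_) _ ?_ ?_ ?_
    · rintro _ _ ⟨rfl, rfl⟩; rfl
    · rintro _ _ ⟨rfl, rfl⟩; rfl
    · rintro _ _ _ ⟨rfl, rfl⟩ ⟨h, -⟩; simp at h
    · rintro _ _ ⟨rfl, rfl⟩; exact h
    · exact exists_balanced_of_pair h (by simp) ⟨rfl, rfl⟩ fun e _ he => (end_eq_or he).symm
    · rintro i hi _ _ ⟨rfl, rfl⟩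
      rw [out_above, (out_below_eq_above_iff w i a).1 (hi _ _ ⟨rfl, rfl⟩),
        ← Equiv.Perm.mul_apply (_ ^ _) (_ ^ _), ← zpow_add, neg_add_cancel, zpow_zero,
        Equiv.Perm.one_apply]
    · intro m i₀
      refine ⟨Function.update (Function.update i₀ (a, .below) (m (a, .below))) (a, .above)
        ((Rack.act' w ^ (D.sign a : ℤ)) (m (a, .below))), fun e he => ?_, ?_⟩
      · rw [Function.update_of_ne, Function.update_of_ne] <;> rintro rfl <;> exact he rfl
      · rintro _ _ ⟨rfl, rfl⟩
        rw [out_below_eq_above_iff]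
        simp
    · intro i i' hoff hon
      obtain ⟨h1, h2, h3⟩ := hon _ _ ⟨rfl, rfl⟩
      funext e
      by_cases he : e.1 = a
      · rcases end_eq_or he with rfl | rfl
        · rw [(out_below_eq_above_iff w i a).1 h2, (out_below_eq_above_iff w i' a).1 h3, h1]
        · exact h1
      · exact hoff e he

/-! ### The second Reidemeister move -/

/-- After the first of two opposite crossings the over-color is `w^(-s) p`, whose action is that of
`p` conjugated by `w^(-s)`. This turns the second factor into the inverse of the first. -/
theorem zhRule_below_mul (w p : X) (s : ℤˣ) :
    zhRule w (-s) .below ((Rack.act' w ^ (-(s : ℤ))) p) * zhRule w s .below p = 1 := by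
  rcases Int.units_eq_one_or s with rfl | rfl
  · simp only [zhRule, Units.val_neg, Units.val_one, zpow_neg, zpow_one,
      Rack.act'_act'_inv_apply]
    group
  · simp only [zhRule, neg_neg, Units.val_neg, Units.val_one, zpow_neg, zpow_one,
      Rack.act'_act'_apply]
    group

theorem card_coloring_omega2 [Finite X] (w : X) (a b : D.Arrow) (hab : a ≠ b)
    (hs : D.sign a = -D.sign b) (h : D.Follows (a, .above) (b, .above))
    (h' : D.Follows (a, .below) (b, .below) ∨ D.Follows (b, .below) (a, .below)) :
    Nat.card (D.Coloring (zhRule w)) = Nat.card ((D.delete {a, b}).Coloring (zhRule w)) := by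
  have hs' : D.sign b = -D.sign a := by rw [hs, neg_neg]
  -- `c` and `d` are `a` and `b` in the order in which the under-strand meets them, which covers
  -- both relative orientations of the strands.
  obtain ⟨c, d, hcd, hc, hd, hS, hf, hcancel⟩ : ∃ c d : D.Arrow, c ≠ d ∧
      c ∈ ({a, b} : Set D.Arrow) ∧ d ∈ ({a, b} : Set D.Arrow) ∧
      (∀ e : D.End, e.1 ∈ ({a, b} : Set D.Arrow) →
        e = (a, .above) ∨ e = (b, .above) ∨ e = (c, .below) ∨ e = (d, .below)) ∧
      D.Follows (c, .below) (d, .below) ∧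
      ∀ i : D.End → X, D.out (zhRule w) i (a, .above) = i (b, .above) →
        D.out (zhRule w) i (c, .below) = i (d, .below) →
        D.out (zhRule w) i (d, .below) = i (c, .below) := by
    have hS : ∀ e : D.End, e.1 ∈ ({a, b} : Set D.Arrow) →
        e = (a, .above) ∨ e = (b, .above) ∨ e = (a, .below) ∨ e = (b, .below) := by
      rintro e (he | he) <;> rcases end_eq_or he with h1 | h1 <;> simp [h1]
    rcases h' with h' | h'
    · refine ⟨a, b, hab, by simp, by simp, hS, h', fun i h1 h2 => ?_⟩
      rw [out_above] at h1
      simp only [out] at h2 ⊢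
      rw [← h1, ← h2, hs', ← Equiv.Perm.mul_apply, zhRule_below_mul, Equiv.Perm.one_apply]
    · refine ⟨b, a, hab.symm, by simp, by simp, fun e he => ?_, h', fun i h1 h2 => ?_⟩
      · have := hS e he
        tauto
      rw [out_above] at h1
      simp only [out] at h2 ⊢
      rw [← h1, hs'] at h2
      rw [← h2, ← Equiv.Perm.mul_apply, mul_eq_one_comm.1 (zhRule_below_mul _ _ _),
        Equiv.Perm.one_apply]
  refine card_coloring_delete (P := fun x y => (x = (a, .above) ∧ y = (b, .above)) ∨
    (x = (c, .below) ∧ y = (d, .below))) ⟨?_, ?_, ?_, ?_⟩ (fun j => ?_) _ ?_ ?_ ?_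
  · rintro _ _ (⟨rfl, rfl⟩ | ⟨rfl, rfl⟩)
    · simp
    · exact hc
  · rintro _ _ (⟨rfl, rfl⟩ | ⟨rfl, rfl⟩)
    · simp
    · exact hd
  · rintro _ _ _ (⟨rfl, rfl⟩ | ⟨rfl, rfl⟩) (⟨h, -⟩ | ⟨h, -⟩) <;> simp at h
    · exact hab h.symm
    · exact hcd h.symm
  · rintro _ _ (⟨rfl, rfl⟩ | ⟨rfl, rfl⟩)
    · exact h
    · exact hf
  · exact exists_balanced_of_pairs h hf (by simpa using hab) (by simpa using hcd) (by simp)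
      (by simp) (by simp) (.inl ⟨rfl, rfl⟩) (.inr ⟨rfl, rfl⟩) hS j
  · intro i hi
    have h1 := hi _ _ (.inl ⟨rfl, rfl⟩)
    have h2 := hi _ _ (.inr ⟨rfl, rfl⟩)
    rintro _ _ (⟨rfl, rfl⟩ | ⟨rfl, rfl⟩)
    · rw [out_above, ← h1, out_above, ← Equiv.Perm.mul_apply (_ ^ _) (_ ^ _), ← zpow_add, hs']
      simp
    · exact hcancel i h1 h2
  · intro m i₀
    -- The over-strand is colored first, because the colors on the under-strand depend on it.
    obtain ⟨i₁, hoff₁, hx₁, ho₁⟩ := exists_extend_pair (D := D) (zhRule w) (x := (a, .above))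
      (y := (b, .above)) (by simpa using hab.symm) (by simpa using hab.symm) (m (a, .above)) i₀
    obtain ⟨i, hoff, hx, ho⟩ := exists_extend_pair (D := D) (zhRule w) (x := (c, .below))
      (y := (d, .below)) (by simpa using hcd.symm) (by simp) (m (c, .below)) i₁
    refine ⟨i, fun e he => ?_, ?_⟩
    · rw [hoff, hoff₁] <;> rintro rfl
      · simp at he
      · simp at he
      · exact he hc
      · exact he hd
    · have habove : ∀ c : D.Arrow, i (c, .above) = i₁ (c, .above) := fun c =>
        hoff _ (by simp) (by simp)
      rintro _ _ (⟨rfl, rfl⟩ | ⟨rfl, rfl⟩)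
      · rw [habove, habove, hx₁, ← ho₁]
        exact ⟨rfl, out_congr (habove a) (habove a)⟩
      · exact ⟨hx, ho⟩
  · intro i i' hoff hon
    obtain ⟨h1, h2, h3⟩ := hon _ _ (.inl ⟨rfl, rfl⟩)
    obtain ⟨k1, k2, k3⟩ := hon _ _ (.inr ⟨rfl, rfl⟩)
    have hb : i (b, .above) = i' (b, .above) := by
      rw [← h2, ← h3]
      exact out_congr h1 h1
    have habove : ∀ c : D.Arrow, i (c, .above) = i' (c, .above) := by
      intro c
      by_cases hc : c ∈ ({a, b} : Set D.Arrow)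
      · rcases hc with rfl | rfl
        · exact h1
        · exact hb
      · exact hoff _ hc
    funext e
    by_cases he : e.1 ∈ ({a, b} : Set D.Arrow)
    · rcases hS e he with rfl | rfl | rfl | rfl
      · exact h1
      · exact hb
      · exact k1
      · rw [← k2, ← k3]
        exact out_congr (habove c) k1
    · exact hoff e he

end GaussDiagram

namespace GaussDiagram

/-! ### The third Reidemeister move -/

/-- `p` and `q` are `e` and `f`, in this order if `x = 1` and in the opposite order if `x = -1`. -/
def InOrder {α : Type*} (x : ℤˣ) (e f p q : α) : Prop :=
  (x = 1 ∧ p = e ∧ q = f) ∨ (x = -1 ∧ p = f ∧ q = e)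

theorem InOrder.or {α : Type*} {x : ℤˣ} {e f p q : α} (h : InOrder x e f p q) :
    (p = e ∧ q = f) ∨ (p = f ∧ q = e) :=
  h.imp And.right And.right

theorem inOrder_one {α : Type*} (e f : α) : InOrder 1 e f e f := .inl ⟨rfl, rfl, rfl⟩

theorem inOrder_neg_one {α : Type*} (e f : α) : InOrder (-1) e f f e := .inr ⟨rfl, rfl, rfl⟩

theorem exists_inOrder {α : Type*} (x : ℤˣ) (e f : α) : ∃ p q, InOrder x e f p q := by
  rcases Int.units_eq_one_or x with rfl | rfl
  · exact ⟨_, _, inOrder_one e f⟩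
  · exact ⟨_, _, inOrder_neg_one e f⟩

theorem AdjacentInOrder.follows {D : GaussDiagram} {x : ℤˣ} {e f p q : D.End}
    (h : D.AdjacentInOrder x e f) (hpq : InOrder x e f p q) : D.Follows p q := by
  rcases hpq with ⟨rfl, rfl, rfl⟩ | ⟨rfl, rfl, rfl⟩ <;> rcases h with ⟨h, hf⟩ | ⟨h, hf⟩
  · exact hf
  · exact absurd h (by decide)
  · exact absurd h (by decide)
  · exact hf

/-! ### Exchanging adjacent endpoints. -/

section Permute

variable {D : GaussDiagram} {τ : Equiv.Perm D.End}

theorem Follows.permute {e f : D.End} (h : D.Follows e f) (τ : Equiv.Perm D.End) :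
    (D.permute τ).Follows (τ e) (τ f) := by
  obtain ⟨j, l, hl, he, hf⟩ := h
  have he' : (l.map τ).getLast? = some (τ e) := by simp [he]
  have hf' : (l.map τ).head? = some (τ f) := by simp [hf]
  exact ⟨j, l.map τ, hl.map τ, he', hf'⟩

theorem follows_of_permute {e f : D.End} (h : (D.permute τ).Follows (τ e) (τ f)) :
    D.Follows e f := by
  obtain ⟨j, (l : List D.End), (hl : (D.word j).map τ ~r l), (he : l.getLast? = some (τ e)),
    (hf : l.head? = some (τ f))⟩ := h
  refine ⟨j, l.map τ.symm, ?_, by simp [he], by simp [hf]⟩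
  simpa [List.map_map] using hl.map τ.symm

theorem permute_permute_of_involutive (h : Function.Involutive τ) :
    (D.permute τ).permute τ = D := by
  have hw : (fun j => ((D.word j).map τ).map τ) = D.word := by
    funext j
    simp [List.map_map, h.comp_self]
  unfold permute
  simp only [hw]

theorem AdjacentInOrder.permute {x : ℤˣ} {e f : D.End} (h : D.AdjacentInOrder x e f)
    (he : τ e = f) (hf : τ f = e) : (D.permute τ).AdjacentInOrder (-x) e f := by
  rcases h with ⟨rfl, h⟩ | ⟨rfl, h⟩
  · refine .inr ⟨rfl, ?_⟩
    have := h.permute τ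
    rwa [he, hf] at this
  · refine .inl ⟨neg_neg _, ?_⟩
    have := h.permute τ
    rwa [he, hf] at this

variable {X : Type*}

/-- `Q p q` says that `p` immediately precedes `q` and the two are exchanged. If each exchanged pair
is entered and left with its old colors, nothing outside the pairs notices the exchange. -/
theorem follows_compatible_permute {K : CrossingRule X} {b : D.Comp → X} {i i' : D.End → X}
    (h : D.IsColoring K b i) {Q : D.End → D.End → Prop} (hQ : ∀ p q, Q p q → D.Follows p q)
    (hτ : ∀ p q, Q p q → τ p = q ∧ τ q = p) (hτ' : ∀ e, (∀ f, ¬ Q e f ∧ ¬ Q f e) → τ e = e)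
    (hi : ∀ p q, Q p q → i' q = i p ∧ D.out K i' q = i' p ∧ D.out K i' p = D.out K i q)
    (hi' : ∀ e, (∀ f, ¬ Q e f ∧ ¬ Q f e) → i' e = i e ∧ D.out K i' e = D.out K i e)
    {e f : D.End} (hef : (D.permute τ).Follows e f) : D.out K i' e = i' f := by
  obtain ⟨e, rfl⟩ := τ.surjective e
  obtain ⟨f, rfl⟩ := τ.surjective f
  have hef := follows_of_permute hef
  by_cases he : ∃ q, Q e q
  · obtain ⟨q, hq⟩ := he
    obtain rfl := (hQ e q hq).right_unique hef
    rw [(hτ e q hq).1, (hτ e q hq).2, (hi e q hq).2.1]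
  by_cases hf : ∃ p, Q p f
  · obtain ⟨p, hp⟩ := hf
    obtain rfl := (hQ p f hp).left_unique hef
    exact absurd ⟨f, hp⟩ he
  -- The color leaving the place of `e` is unchanged, whichever endpoint now occupies it.
  have h1 : D.out K i' (τ e) = D.out K i e := by
    by_cases he' : ∃ p, Q p e
    · obtain ⟨p, hp⟩ := he'
      rw [(hτ p e hp).2, (hi p e hp).2.2]
    · have hn : ∀ f, ¬ Q e f ∧ ¬ Q f e := fun f => ⟨fun h => he ⟨f, h⟩, fun h => he' ⟨f, h⟩⟩
      rw [hτ' e hn, (hi' e hn).2]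
  have h2 : i' (τ f) = i f := by
    by_cases hf' : ∃ q, Q f q
    · obtain ⟨q, hq⟩ := hf'
      rw [(hτ f q hq).1, (hi f q hq).1]
    · have hn : ∀ e, ¬ Q f e ∧ ¬ Q e f := fun e => ⟨fun h => hf' ⟨e, h⟩, fun h => hf ⟨e, h⟩⟩
      rw [hτ' f hn, (hi' f hn).1]
  rw [h1, h2, h.out_eq hef]

theorem exists_extend_inOrder (K : CrossingRule X) (x : ℤˣ) {e f : D.End} (hef : f ≠ e)
    (hef' : f ≠ (e.1, .above)) (hfe' : e ≠ (f.1, .above)) (i i₀ : D.End → X) :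
    ∃ i', (∀ c, c ≠ e → c ≠ f → i' c = i₀ c) ∧
      ∀ p q, InOrder x e f p q → i' q = i p ∧ D.out K i' q = i' p := by
  rcases Int.units_eq_one_or x with rfl | rfl
  · obtain ⟨i', h1, h2, h3⟩ := exists_extend_pair (D := D) K (x := f) (y := e) hef.symm
      hfe' (i e) i₀
    refine ⟨i', fun c hc hc' => h1 c hc' hc, ?_⟩
    rintro p q (⟨-, rfl, rfl⟩ | ⟨h, -⟩)
    · exact ⟨h2, h3⟩
    · exact absurd h (by decide)
  · obtain ⟨i', h1, h2, h3⟩ := exists_extend_pair (D := D) K (x := e) (y := f) hef hef' (i f) i₀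
    refine ⟨i', fun c hc hc' => h1 c hc hc', ?_⟩
    rintro p q (⟨h, -⟩ | ⟨-, rfl, rfl⟩)
    · exact absurd h (by decide)
    · exact ⟨h2, h3⟩

theorem incoming_eq_of_inOrder {K : CrossingRule X} {b₁ b₂ : D.Comp → X} {i₁ i₂ : D.End → X}
    (h₁ : D.IsColoring K b₁ i₁) (h₂ : D.IsColoring K b₂ i₂) {x : ℤˣ} {e f : D.End}
    (hf : D.AdjacentInOrder x e f)
    (h : ∀ p q, InOrder x e f p q → i₁ p = i₂ p ∧ i₁ (p.1, .above) = i₂ (p.1, .above)) :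
    i₁ e = i₂ e ∧ i₁ f = i₂ f := by
  obtain ⟨p, q, hpq⟩ := exists_inOrder x e f
  obtain ⟨hp, hp'⟩ := h p q hpq
  have hfol := hf.follows hpq
  have hq : i₁ q = i₂ q := by
    rw [← h₁.out_eq hfol, ← h₂.out_eq hfol]
    exact out_congr hp' hp
  rcases hpq.or with ⟨rfl, rfl⟩ | ⟨rfl, rfl⟩
  · exact ⟨hp, hq⟩
  · exact ⟨hq, hp⟩

end Permute

/-! ### The algebra of a triangle. -/

section Triangle

variable {D : GaussDiagram} {tm tb mb : D.Arrow}

theorem triangleSwap_apply (h₁ : tm ≠ tb) (h₂ : tm ≠ mb) (h₃ : tb ≠ mb) :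
    D.triangleSwap tm tb mb (tm, .above) = (tb, .above) ∧
    D.triangleSwap tm tb mb (tb, .above) = (tm, .above) ∧
    D.triangleSwap tm tb mb (tm, .below) = (mb, .above) ∧
    D.triangleSwap tm tb mb (mb, .above) = (tm, .below) ∧
    D.triangleSwap tm tb mb (tb, .below) = (mb, .below) ∧
    D.triangleSwap tm tb mb (mb, .below) = (tb, .below) := by
  simp [triangleSwap, Equiv.swap_apply_def, h₁, h₂, h₃, h₁.symm, h₂.symm, h₃.symm]

theorem triangleSwap_apply_of_ne {e : D.End} (h₁ : e ≠ (tm, .above)) (h₂ : e ≠ (tb, .above))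
    (h₃ : e ≠ (tm, .below)) (h₄ : e ≠ (mb, .above)) (h₅ : e ≠ (tb, .below))
    (h₆ : e ≠ (mb, .below)) : D.triangleSwap tm tb mb e = e := by
  classical
  rw [triangleSwap, Equiv.Perm.mul_apply, Equiv.Perm.mul_apply, Equiv.swap_apply_of_ne_of_ne h₅ h₆,
    Equiv.swap_apply_of_ne_of_ne h₃ h₄, Equiv.swap_apply_of_ne_of_ne h₁ h₂]

theorem triangleSwap_involutive (h₁ : tm ≠ tb) (h₂ : tm ≠ mb) (h₃ : tb ≠ mb) :
    Function.Involutive (D.triangleSwap tm tb mb) := by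
  obtain ⟨k1, k2, k3, k4, k5, k6⟩ := triangleSwap_apply h₁ h₂ h₃
  intro e
  by_cases e1 : e = (tm, .above)
  · rw [e1, k1, k2]
  by_cases e2 : e = (tb, .above)
  · rw [e2, k2, k1]
  by_cases e3 : e = (tm, .below)
  · rw [e3, k3, k4]
  by_cases e4 : e = (mb, .above)
  · rw [e4, k4, k3]
  by_cases e5 : e = (tb, .below)
  · rw [e5, k5, k6]
  by_cases e6 : e = (mb, .below)
  · rw [e6, k6, k5]
  have := triangleSwap_apply_of_ne e1 e2 e3 e4 e5 e6
  rw [this, this]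

theorem IsTriangle.permute (h : D.IsTriangle tm tb mb) :
    (D.permute (D.triangleSwap tm tb mb)).IsTriangle tm tb mb := by
  obtain ⟨h₁, h₂, h₃, xt, xm, xb, ht, hm, hb, e1, e2⟩ := h
  obtain ⟨k1, k2, k3, k4, k5, k6⟩ := triangleSwap_apply h₁ h₂ h₃
  refine ⟨h₁, h₂, h₃, -xt, -xm, -xb, ht.permute k1 k2, hm.permute k3 k4, hb.permute k5 k6, ?_, ?_⟩
  · rw [neg_mul, neg_mul]
    exact congrArg _ e1
  · rw [neg_mul, neg_mul]
    exact congrArg _ e2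

theorem IsTriangle.permute_permute (h : D.IsTriangle tm tb mb) :
    (D.permute (D.triangleSwap tm tb mb)).permute
      ((D.permute (D.triangleSwap tm tb mb)).triangleSwap tm tb mb) = D :=
  permute_permute_of_involutive (triangleSwap_involutive h.1 h.2.1 h.2.2.1)

variable {X : Type*} [Quandle X]

/-- On the top strand only powers of the action of `w` occur, and these commute. -/
theorem zhRule_triangle_top (w : X) {xt stm stb : ℤˣ} {tA tB tA' tB' : X}
    (ht : (xt = 1 ∧ tB = zhRule w stm .above tA tA ∧ tB' = tA ∧
        tA' = zhRule w stb .above tB' tB') ∨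
      (xt = -1 ∧ tA = zhRule w stb .above tB tB ∧ tA' = tB ∧
        tB' = zhRule w stm .above tA' tA')) :
    (xt = 1 → zhRule w stm .above tA' tA' = zhRule w stb .above tB tB) ∧
      (xt = -1 → zhRule w stb .above tB' tB' = zhRule w stm .above tA tA) := by
  have h1 : (1 : ℤˣ) ≠ -1 := by decide
  rcases ht with ⟨rfl, rfl, rfl, rfl⟩ | ⟨rfl, rfl, rfl, rfl⟩ <;>
  simp only [h1, h1.symm, forall_const, IsEmpty.forall_iff, true_and, and_true] <;>
  simp only [zhRule, ← Equiv.Perm.mul_apply, ← zpow_add, add_comm]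

/-- The sign condition leaves one free sign `σ` besides the three orders, hence sixteen cases. -/
theorem units_triangle_cases {xt xm xb stm stb smb : ℤˣ} (h₁ : xt * smb = xm * stb)
    (h₂ : xm * stb = xb * stm) : ∃ σ : ℤˣ, smb = xt * σ ∧ stb = xm * σ ∧ stm = xb * σ := by
  refine ⟨xm * stb, ?_, ?_, ?_⟩
  · rw [← h₁, ← mul_assoc, Int.units_mul_self, one_mul]
  · rw [← mul_assoc, Int.units_mul_self, one_mul]
  · rw [h₂, ← mul_assoc, Int.units_mul_self, one_mul]

/-- The colors along the middle and the bottom strand are compatible with the third Reidemeister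
move. -/
theorem zhRule_triangle (w : X) {xt xm xb stm stb smb : ℤˣ} (h₁ : xt * smb = xm * stb)
    (h₂ : xm * stb = xb * stm) {tA tB mA mB bA bB tA' tB' mA' mB' bA' bB' : X}
    (ht : (xt = 1 ∧ tB = zhRule w stm .above tA tA ∧ tB' = tA ∧
        tA' = zhRule w stb .above tB' tB') ∨
      (xt = -1 ∧ tA = zhRule w stb .above tB tB ∧ tA' = tB ∧ tB' = zhRule w stm .above tA' tA'))
    (hm : (xm = 1 ∧ mB = zhRule w stm .below tA mA ∧ mB' = mA ∧
        mA' = zhRule w smb .above mB' mB') ∨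
      (xm = -1 ∧ mA = zhRule w smb .above mB mB ∧ mA' = mB ∧ mB' = zhRule w stm .below tA' mA'))
    (hb : (xb = 1 ∧ bB = zhRule w stb .below tB bA ∧ bB' = bA ∧
        bA' = zhRule w smb .below mB' bB') ∨
      (xb = -1 ∧ bA = zhRule w smb .below mB bB ∧ bA' = bB ∧ bB' = zhRule w stb .below tB' bA')) :
    ((xm = 1 → zhRule w stm .below tA' mA' = zhRule w smb .above mB mB) ∧
      (xm = -1 → zhRule w smb .above mB' mB' = zhRule w stm .below tA mA)) ∧
    ((xb = 1 → zhRule w stb .below tB' bA' = zhRule w smb .below mB bB) ∧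
      (xb = -1 → zhRule w smb .below mB' bB' = zhRule w stb .below tB bA)) := by
  obtain ⟨σ, rfl, rfl, rfl⟩ := units_triangle_cases h₁ h₂
  have h1 : (1 : ℤˣ) ≠ -1 := by decide
  rcases ht with ⟨rfl, rfl, rfl, rfl⟩ | ⟨rfl, rfl, rfl, rfl⟩ <;>
  rcases hm with ⟨rfl, rfl, rfl, rfl⟩ | ⟨rfl, rfl, rfl, rfl⟩ <;>
  rcases hb with ⟨rfl, rfl, rfl, rfl⟩ | ⟨rfl, rfl, rfl, rfl⟩ <;>
  simp only [h1, h1.symm, forall_const, IsEmpty.forall_iff, true_and, and_true] <;>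
  rcases Int.units_eq_one_or σ with rfl | rfl <;>
  simp only [one_mul, neg_mul, neg_neg, mul_one, zhRule, Units.val_one, Units.val_neg, zpow_neg,
    zpow_one, Equiv.Perm.mul_apply, Rack.act'_act'_apply, Rack.act'_act'_inv_apply, mul_inv_rev,
    inv_inv] <;>
  simp only [← Equiv.Perm.mul_apply] <;>
  -- With all actions of translated colors written as conjugates, each claim is an identity between
  -- group words.
  constructor <;> refine DFunLike.congr_fun (F := Equiv.Perm X) ?_ _ <;>
  simp only [inv_mul_cancel_left, mul_inv_cancel_left, inv_mul_cancel,
    mul_inv_cancel, mul_one]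

end Triangle

end GaussDiagram

/-! ### Counting colorings across the third move. -/

namespace GaussDiagram

variable {X : Type*} [Quandle X]

theorem card_coloring_le_omega3 [Finite X] (w : X) {D : GaussDiagram} {tm tb mb : D.Arrow}
    (h : D.IsTriangle tm tb mb) : Nat.card (D.Coloring (zhRule w)) ≤
      Nat.card ((D.permute (D.triangleSwap tm tb mb)).Coloring (zhRule w)) := by
  obtain ⟨n1, n2, n3, xt, xm, xb, ht, hm, hb, s1, s2⟩ := h
  obtain ⟨k1, k2, k3, k4, k5, k6⟩ := triangleSwap_apply n1 n2 n3
  set τ := D.triangleSwap tm tb mb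
  set Q : D.End → D.End → Prop := fun p q => InOrder xt (tm, .above) (tb, .above) p q ∨
    InOrder xm (tm, .below) (mb, .above) p q ∨ InOrder xb (tb, .below) (mb, .below) p q with hQdef
  have hQ : ∀ p q, Q p q → D.Follows p q := by
    rintro p q (h | h | h)
    exacts [ht.follows h, hm.follows h, hb.follows h]
  have hτ : ∀ p q, Q p q → τ p = q ∧ τ q = p := by
    rintro p q (h | h | h) <;> rcases h.or with ⟨rfl, rfl⟩ | ⟨rfl, rfl⟩
    exacts [⟨k1, k2⟩, ⟨k2, k1⟩, ⟨k3, k4⟩, ⟨k4, k3⟩, ⟨k5, k6⟩, ⟨k6, k5⟩]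
  have hoff : ∀ e : D.End, (∀ f, ¬ Q e f ∧ ¬ Q f e) → (e ≠ (tm, .above) ∧ e ≠ (tb, .above)) ∧
      (e ≠ (tm, .below) ∧ e ≠ (mb, .above)) ∧ e ≠ (tb, .below) ∧ e ≠ (mb, .below) := by
    have aux : ∀ (x : ℤˣ) (e f c : D.End), (∀ d, ¬ InOrder x e f c d ∧ ¬ InOrder x e f d c) →
        c ≠ e ∧ c ≠ f := by
      intro x e f c hc
      obtain ⟨p, q, hpq⟩ := exists_inOrder x e f
      rcases hpq.or with ⟨rfl, rfl⟩ | ⟨rfl, rfl⟩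
      · exact ⟨by rintro rfl; exact (hc _).1 hpq, by rintro rfl; exact (hc _).2 hpq⟩
      · exact ⟨by rintro rfl; exact (hc _).2 hpq, by rintro rfl; exact (hc _).1 hpq⟩
    intro e he
    refine ⟨aux xt _ _ e fun d => ?_, aux xm _ _ e fun d => ?_, aux xb _ _ e fun d => ?_⟩
    · exact ⟨fun h => (he d).1 (.inl h), fun h => (he d).2 (.inl h)⟩
    · exact ⟨fun h => (he d).1 (.inr (.inl h)), fun h => (he d).2 (.inr (.inl h))⟩
    · exact ⟨fun h => (he d).1 (.inr (.inr h)), fun h => (he d).2 (.inr (.inr h))⟩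
  have hτ' : ∀ e, (∀ f, ¬ Q e f ∧ ¬ Q f e) → τ e = e := by
    intro e he
    obtain ⟨⟨h1, h2⟩, ⟨h3, h4⟩, h5, h6⟩ := hoff e he
    exact triangleSwap_apply_of_ne h1 h2 h3 h4 h5 h6
  -- Related colorings agree off the triangle and enter each of its three sides with the same color.
  refine GaussDiagram.card_coloring_le (fun b i b' i' => (∀ j, D.word j = [] → b' j = b j) ∧
    (∀ e, (∀ f, ¬ Q e f ∧ ¬ Q f e) → i' e = i e) ∧ ∀ p q, Q p q → i' q = i p) ?_ ?_
  · intro b i hi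
    -- The new colors are built from the top strand down, as each crossing uses the color of the
    -- strand above it.
    obtain ⟨i₁, hoff₁, hi₁⟩ := exists_extend_inOrder (D := D) (zhRule w) xt
      (e := (tm, .above)) (f := (tb, .above)) (by simp [n1.symm]) (by simp [n1.symm])
      (by simp [n1]) i i
    obtain ⟨i₂, hoff₂, hi₂⟩ := exists_extend_inOrder (D := D) (zhRule w) xm
      (e := (tm, .below)) (f := (mb, .above)) (by simp) (by simp [n2.symm]) (by simp) i i₁
    obtain ⟨i', hoff₃, hi₃⟩ := exists_extend_inOrder (D := D) (zhRule w) xb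
      (e := (tb, .below)) (f := (mb, .below)) (by simp [n3.symm]) (by simp) (by simp) i i₂
    have h₂ : ∀ e, e ≠ (tm, .below) → e ≠ (mb, .above) → e ≠ (tb, .below) → e ≠ (mb, .below) →
        i' e = i₁ e := fun e h1 h2 h3 h4 => (hoff₃ e h3 h4).trans (hoff₂ e h1 h2)
    have htop : ∀ c, i' (c, .above) = i₂ (c, .above) := fun c => hoff₃ _ (by simp) (by simp)
    have htm : i' (tm, .above) = i₁ (tm, .above) :=
      h₂ _ (by simp) (by simp [n2]) (by simp) (by simp)
    have htb : i' (tb, .above) = i₁ (tb, .above) :=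
      h₂ _ (by simp) (by simp [n3]) (by simp) (by simp)
    have Ht : ∀ p q, InOrder xt (tm, .above) (tb, .above) p q →
        i' q = i p ∧ D.out (zhRule w) i' q = i' p := by
      intro p q h
      obtain ⟨h1, h2⟩ := hi₁ p q h
      rcases h.or with ⟨rfl, rfl⟩ | ⟨rfl, rfl⟩
      · exact ⟨htb.trans h1, (out_congr htb htb).trans (h2.trans htm.symm)⟩
      · exact ⟨htm.trans h1, (out_congr htm htm).trans (h2.trans htb.symm)⟩
    have Hm : ∀ p q, InOrder xm (tm, .below) (mb, .above) p q →
        i' q = i p ∧ D.out (zhRule w) i' q = i' p := by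
      intro p q h
      obtain ⟨h1, h2⟩ := hi₂ p q h
      have htm' : i' (tm, .below) = i₂ (tm, .below) := hoff₃ _ (by simp [n1]) (by simp [n2])
      rcases h.or with ⟨rfl, rfl⟩ | ⟨rfl, rfl⟩
      · exact ⟨(htop _).trans h1, (out_congr (htop _) (htop _)).trans (h2.trans htm'.symm)⟩
      · exact ⟨htm'.trans h1, (out_congr (htop _) htm').trans (h2.trans (htop _).symm)⟩
    have hor : ∀ (x : ℤˣ) (e f : D.End), D.AdjacentInOrder x e f →
        (∀ p q, InOrder x e f p q → i' q = i p ∧ D.out (zhRule w) i' q = i' p) →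
        (x = 1 ∧ i f = D.out (zhRule w) i e ∧ i' f = i e ∧ i' e = D.out (zhRule w) i' f) ∨
        (x = -1 ∧ i e = D.out (zhRule w) i f ∧ i' e = i f ∧ i' f = D.out (zhRule w) i' e) := by
      rintro x e f (⟨rfl, hef⟩ | ⟨rfl, hef⟩) H
      · obtain ⟨h1, h2⟩ := H _ _ (inOrder_one e f)
        exact .inl ⟨rfl, (hi.out_eq hef).symm, h1, h2.symm⟩
      · obtain ⟨h1, h2⟩ := H _ _ (inOrder_neg_one e f)
        exact .inr ⟨rfl, (hi.out_eq hef).symm, h1, h2.symm⟩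
    have ot := hor _ _ _ ht Ht
    have om := hor _ _ _ hm Hm
    have ob := hor _ _ _ hb hi₃
    -- These facts say that the colors leaving the three sides are unchanged.
    have at_top := zhRule_triangle_top w ot
    obtain ⟨at_mid, at_bot⟩ := zhRule_triangle w s1 s2 ot om ob
    have hiQ : ∀ p q, Q p q → i' q = i p ∧ D.out (zhRule w) i' q = i' p ∧
        D.out (zhRule w) i' p = D.out (zhRule w) i q := by
      rintro p q (h | h | h)
      · refine ⟨(Ht p q h).1, (Ht p q h).2, ?_⟩
        rcases h with ⟨hx, rfl, rfl⟩ | ⟨hx, rfl, rfl⟩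
        exacts [at_top.1 hx, at_top.2 hx]
      · refine ⟨(Hm p q h).1, (Hm p q h).2, ?_⟩
        rcases h with ⟨hx, rfl, rfl⟩ | ⟨hx, rfl, rfl⟩
        exacts [at_mid.1 hx, at_mid.2 hx]
      · refine ⟨(hi₃ p q h).1, (hi₃ p q h).2, ?_⟩
        rcases h with ⟨hx, rfl, rfl⟩ | ⟨hx, rfl, rfl⟩
        exacts [at_bot.1 hx, at_bot.2 hx]
    have hioff : ∀ e, (∀ f, ¬ Q e f ∧ ¬ Q f e) → i' e = i e ∧
        D.out (zhRule w) i' e = D.out (zhRule w) i e := by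
      intro e he
      obtain ⟨⟨h1, h2⟩, ⟨h3, h4⟩, h5, h6⟩ := hoff e he
      have hne : ∀ c, e ≠ (c, .above) → e ≠ (c, .below) → e.1 ≠ c := fun c hc hc' h =>
        (end_eq_or h).elim hc hc'
      have htm' := hne tm h1 h3
      have htb' := hne tb h2 h5
      have hmb' := hne mb h4 h6
      have he' : i' e = i e := (h₂ e h3 h4 h5 h6).trans (hoff₁ e h1 h2)
      refine ⟨he', out_congr ?_ he'⟩
      rw [h₂ _ (by simp) (by simp [hmb']) (by simp) (by simp),
        hoff₁ _ (by simp [htm']) (by simp [htb'])]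
    refine ⟨_, i', isColoring_baseColor (D := D.permute τ) b fun e f hef =>
      follows_compatible_permute hi hQ hτ hτ' hiQ hioff hef, fun j hj => ?_,
      fun e he => (hioff e he).1, fun p q h => (hiQ p q h).1⟩
    refine baseColor_of_nil _ _ ?_
    change (D.word j).map τ = []
    rw [hj, List.map_nil]
  · rintro b₁ i₁ b₂ i₂ b' i' h₁ h₂ - ⟨hb₁, hoff₁, hi₁⟩ ⟨hb₂, hoff₂, hi₂⟩
    have key : ∀ p q, Q p q → i₁ p = i₂ p := fun p q h => (hi₁ p q h).symm.trans (hi₂ p q h)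
    -- The entering colors determine the colors inside, again from top to bottom.
    obtain ⟨t1, t2⟩ := incoming_eq_of_inOrder h₁ h₂ ht fun p q h => by
      have := key p q (.inl h)
      rcases h.or with ⟨rfl, rfl⟩ | ⟨rfl, rfl⟩ <;> exact ⟨this, this⟩
    obtain ⟨m1, m2⟩ := incoming_eq_of_inOrder h₁ h₂ hm fun p q h => by
      have := key p q (.inr (.inl h))
      rcases h.or with ⟨rfl, rfl⟩ | ⟨rfl, rfl⟩
      exacts [⟨this, t1⟩, ⟨this, this⟩]
    obtain ⟨l1, l2⟩ := incoming_eq_of_inOrder h₁ h₂ hb fun p q h => by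
      have := key p q (.inr (.inr h))
      rcases h.or with ⟨rfl, rfl⟩ | ⟨rfl, rfl⟩
      exacts [⟨this, t2⟩, ⟨this, m2⟩]
    have hi : i₁ = i₂ := by
      funext e
      by_cases he : ∀ f, ¬ Q e f ∧ ¬ Q f e
      · rw [← hoff₁ e he, ← hoff₂ e he]
      · simp only [not_forall, not_and_or, not_not] at he
        obtain ⟨f, (h | h | h) | (h | h | h)⟩ := he <;>
          rcases h.or with ⟨rfl, rfl⟩ | ⟨rfl, rfl⟩ <;> assumption
    subst hi
    exact ⟨h₁.ext h₂ fun j hj => (hb₁ j hj).symm.trans (hb₂ j hj), rfl⟩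

/-- The move is its own inverse, so one inequality suffices. -/
theorem card_coloring_omega3 [Finite X] (w : X) {D : GaussDiagram} {tm tb mb : D.Arrow}
    (h : D.IsTriangle tm tb mb) : Nat.card (D.Coloring (zhRule w)) =
      Nat.card ((D.permute (D.triangleSwap tm tb mb)).Coloring (zhRule w)) := by
  refine le_antisymm (card_coloring_le_omega3 w h) ?_
  have := card_coloring_le_omega3 w h.permute
  rwa [h.permute_permute] at this

/-! ### Invariance for a fixed color of `ω`, and summation over all colors. -/

theorem VirtuallyEquivalent.card_coloring_eq [Finite X] (w : X) {D D' : GaussDiagram}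
    (h : D.VirtuallyEquivalent D') :
    Nat.card (D.Coloring (zhRule w)) = Nat.card (D'.Coloring (zhRule w)) := by
  induction h with
  | rel _ _ h =>
    cases h with
    | iso h => exact h.card_coloring_eq _
    | omega1 a h => exact card_coloring_omega1 w a h
    | omega2 a b hab hs h h' => exact card_coloring_omega2 w a b hab hs h h'
    | omega3 tm tb mb h => exact card_coloring_omega3 w h
  | refl => rfl
  | symm _ _ _ ih => exact ih.symm
  | trans _ _ _ _ _ ih ih' => exact ih.trans ih'

theorem nonempty_col_zh_equiv (X : Type*) [Quandle X] {D : GaussDiagram} (z : D.ZhChoice) :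
    Nonempty ((D.zh z).Col X ≃ Σ w : X, D.Coloring (zhRule w)) := by
  obtain ⟨e⟩ := nonempty_col_equiv_coloring X (D.zh z)
  obtain ⟨e'⟩ := nonempty_coloring_zh_equiv X z
  exact ⟨e.trans e'⟩

end GaussDiagram

theorem mainTheorem8 {X : Type*} [Quandle X] [Finite X] (D₀ D₁ : GaussDiagram)
    (h : D₀.VirtuallyEquivalent D₁) (z₀ : D₀.ZhChoice) (z₁ : D₁.ZhChoice) :
    Finite (GaussDiagram.Col X (D₀.zh z₀)) ∧ Finite (GaussDiagram.Col X (D₁.zh z₁)) ∧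
      Nat.card (GaussDiagram.Col X (D₀.zh z₀)) = Nat.card (GaussDiagram.Col X (D₁.zh z₁)) := by
  obtain ⟨e₀⟩ := GaussDiagram.nonempty_col_zh_equiv X z₀
  obtain ⟨e₁⟩ := GaussDiagram.nonempty_col_zh_equiv X z₁
  refine ⟨.of_equiv _ e₀.symm, .of_equiv _ e₁.symm, ?_⟩
  have := Fintype.ofFinite X
  rw [Nat.card_congr e₀, Nat.card_congr e₁, Nat.card_sigma, Nat.card_sigma]
  exact Finset.sum_congr rfl fun w _ => h.card_coloring_eq w
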